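/- All alphabets are finite and all logarithms are to base $2$; $|a|^+:=\max\{a,0\}$. Let $W:\mathcal X\to\mathcal Y\times\mathcal Z$ be a discrete memoryless broadcast channel with $\mathcal Y$-marginal $W_{\mathcal Y}$, let $\mathcal U$ be a finite set, let $P_{UX}$ be a probability distribution on $\mathcal U\times\mathcal X$, and let $R_1,R_2\ge 0$, $R_{12}:=R_1+R_2$. The messages $M_1,M_2$ are uniform and independent on $\mathcal M_j=\{1,\dots,\lceil 2^{nR_j}\rceil\}$. An $(n,R_1,R_2)$-code consists of an encoder $f:\mathcal M_1\times\mathcal M_2\to\mathcal X^n$, a decoder $\varphi_1:\mathcal Y^n\to(\mathcal M_1\cup\{\mathrm e_1\})\times(\mathcal M_2\cup\{\mathrm e_2\})$ at the main terminal $\mathcal Y$ and a decoder $\varphi_2:\mathcal Z^n\to\mathcal M_2\cup\{\mathrm e_2\}$, where $\mathrm e_j$ denotes an erasure. For $j=1,2$ let $e_j$ be the probability that the $j$-th component of $\varphi_1(Y^n)$ is not $M_j$ (total error), and let $\hat e_j$ be the probability that it is an element of $\mathcal M_j\setminus\{M_j\}$ (undetected error), both averaged over the messages. Superposition code and decoder.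 A codebook consists of cloud centers $\mathbf u(m_2)\in\mathcal U^n$ and satellite codewords $\mathbf x(m_1,m_2)\in\mathcal X^n$; the encoder sends $\mathbf x(m_1,m_2)$. Let $\hat I$ denote empirical mutual information. Given $\tilde R_j\ge R_j$ $(j=1,2)$ and $\lambda_{12},\lambda_2\ge1$, put $\tilde R_{12}:=\tilde R_1+\tilde R_2$; the two-step decoder at $\mathcal Y$ works as follows. Step 1: output $(\hat m_1,\hat m_2)$ if it is the unique pair with $$\hat I(\mathbf u(\hat m_2),\mathbf x(\hat m_1,\hat m_2)\wedge\mathbf y)\ge\tilde R_{12}+\lambda_{12}\big|\hat I(\mathbf u(\tilde m_2),\mathbf x(\tilde m_1,\tilde m_2)\wedge\mathbf y)-R_{12}\big|^+\quad\text{for all }(\tilde m_1,\tilde m_2)\ne(\hat m_1,\hat m_2).$$ Step 2: if there is no such unique pair, output $(\mathrm e_1,\hat m_2)$ if $\hat m_2$ is the unique message with $$\hat I(\mathbf u(\hat m_2)\wedge\mathbf y)\ge\tilde R_2+\lambda_2\big|\hat I(\mathbf u(\tilde m_2)\wedge\mathbf y)-R_2\big|^+\quad\text{for all }\tilde m_2\ne\hat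 m_2,$$ and output $(\mathrm e_1,\mathrm e_2)$ if there is no such unique message. Exponents. For stochastic matrices $V:\mathcal U\times\mathcal X\to\mathcal Y$ and $\hat V:\mathcal U\to\mathcal Y$ let $I_V$ and $I_{\hat V}$ denote mutual information under the joint laws $P_{UX}\times V$ and $P_U\times\hat V$. Let $D(\cdot\|\cdot|\cdot)$ be the conditional divergence, let $W(y|u,x):=W_{\mathcal Y}(y|x)$ and $W_{Y|U}(y|u):=\sum_xW_{\mathcal Y}(y|x)P_{X|U}(x|u)$. Define, for $\lambda>0$ and real $a_1,a_2,b$, $$E_{\mathrm r,\lambda}(a_2):=\min_{\hat V}\Big[D(\hat V\|W_{Y|U}|P_U)+\lambda\,|I_{\hat V}(U\wedge Y)-a_2|^+\Big],$$ $$E_{\mathrm r,\lambda}(a_1,a_2):=\min_V\Big[D(V\|W|P_{UX})+\lambda\,|I_V(UX\wedge Y)-a_1-a_2|^+\Big],$$ $$E^-_{\mathrm r,\lambda}(a_1,a_2,b):=\min_V\Big[D(V\|W|P_{UX})+\lambda\,|I_V(UX\wedge Y)-a_1-a_2|^+-|I_V(U\wedge Y)-b|^+\Big],$$ and $\Delta_{12}:=\tilde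 R_{12}-R_{12}$, $\Delta_2:=\tilde R_2-R_2$. Theorem. For every $W$, $P_{UX}$, $R_1$, $R_2$ as above there is a sequence of superposition codebooks, one for each blocklength $n$, in which all pairs $(\mathbf u(m_2),\mathbf x(m_1,m_2))$ have one and the same joint type, these types converging to $P_{UX}$ as $n\to\infty$, such that for every choice of $\tilde R_1\ge R_1$, $\tilde R_2\ge R_2$, $\lambda_{12}\ge1$, $\lambda_2\ge1$ the $(n,R_1,R_2)$-codes formed by these codebooks and the corresponding two-step decoder at $\mathcal Y$ (and any decoder at $\mathcal Z$) satisfy $$\liminf_{n\to\infty}\tfrac1n\log\tfrac1{e_1}\ge E^-_{\mathrm r,1/\lambda_{12}}(\tilde R_1,\tilde R_2,R_2),$$ $$\liminf_{n\to\infty}\tfrac1n\log\tfrac1{\hat e_1}\ge E^-_{\mathrm r,\lambda_{12}}(R_1,R_2,R_2)+\Delta_{12},$$ $$\liminf_{n\to\infty}\tfrac1n\log\tfrac1{e_2}\ge\min\Big\{E_{\mathrm r,\lambda_{12}}(R_1,R_2)+\Delta_{12},\ \max\big\{E^-_{\mathrm r,1/\lambda_{12}}(\tilde R_1,\tilde R_2,R_2),\,E_{\mathrm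 r,1/\lambda_2}(\tilde R_2)\big\}\Big\},$$ $$\liminf_{n\to\infty}\tfrac1n\log\tfrac1{\hat e_2}\ge\min\Big\{E_{\mathrm r,\lambda_{12}}(R_1,R_2)+\Delta_{12},\ \max\big\{E^-_{\mathrm r,1/\lambda_{12}}(\tilde R_1,\tilde R_2,R_2),\,E_{\mathrm r,\lambda_2}(R_2)+\Delta_2\big\}\Big\},$$ where $\log(1/0):=+\infty$. -/

import Mathlib

open Filter Topology

noncomputable section

namespace ABC

/-! ### Finite-alphabet information quantities (all logarithms are to base 2) -/

section Info

variable {α β : Type*} [Fintype α] [Fintype β]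

/-- The joint distribution `P × V` of an input law `P` and a stochastic matrix `V`. -/
def joint (P : α → ℝ) (V : α → β → ℝ) : α × β → ℝ := fun p => P p.1 * V p.1 p.2

/-- First marginal. -/
def fstMarg (Q : α × β → ℝ) : α → ℝ := fun a => ∑ b, Q (a, b)

/-- Second marginal. -/
def sndMarg (Q : α × β → ℝ) : β → ℝ := fun b => ∑ a, Q (a, b)

/-- Mutual information of a joint distribution `Q` on `α × β`
(terms with `Q (a, b) = 0` contribute `0`). -/
def mutualInfo (Q : α × β → ℝ) : ℝ :=
  ∑ a, ∑ b, Q (a, b) * Real.logb 2 (Q (a, b) / (fstMarg Q a * sndMarg Q b))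

open Classical in
/-- Conditional divergence `D(V ‖ W | P)`; it is `⊤` unless `V(·|a) ≪ W(·|a)`
for every `a` with `P a ≠ 0`. -/
def condKL (V W : α → β → ℝ) (P : α → ℝ) : EReal :=
  if ∀ a b, P a ≠ 0 → W a b = 0 → V a b = 0 then
    ((∑ a, P a * ∑ b, V a b * Real.logb 2 (V a b / W a b) : ℝ) : EReal)
  else ⊤

end Info

/-! ### Types of sequences -/

open Classical in
/-- The type (empirical distribution) of a sequence. -/
def seqType {α : Type*} {n : ℕ} (s : Fin n → α) : α → ℝ :=
  fun a => ((Finset.univ.filter fun i => s i = a).card : ℝ) / n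

/-- Two sequences regarded as one sequence of pairs. -/
def pairSeq {α β : Type*} {n : ℕ} (s : Fin n → α) (t : Fin n → β) : Fin n → α × β :=
  fun i => (s i, t i)

/-- Empirical mutual information of two sequences. -/
def empInfo {α β : Type*} [Fintype α] [Fintype β] {n : ℕ}
    (s : Fin n → α) (t : Fin n → β) : ℝ :=
  mutualInfo (seqType (pairSeq s t))

/-! ### Codes and error probabilities -/

/-- The message set with `⌈2 ^ (n R)⌉` elements. -/
abbrev Msg (n : ℕ) (R : ℝ) : Type := Fin ⌈(2 : ℝ) ^ ((n : ℝ) * R)⌉₊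

/-- An `(n, R₁, R₂)`-code for a broadcast channel with degraded message sets;
`none` is the erasure symbol. -/
structure Code (X Y Z : Type*) (n : ℕ) (R₁ R₂ : ℝ) where
  enc : Msg n R₁ → Msg n R₂ → Fin n → X
  decY : (Fin n → Y) → Option (Msg n R₁) × Option (Msg n R₂)
  decZ : (Fin n → Z) → Option (Msg n R₂)

/-- The `Y`-marginal of the broadcast channel. -/
def margY {X Y Z : Type*} [Fintype Y] [Fintype Z]
    (W : X → stdSimplex ℝ (Y × Z)) : X → Y → ℝ :=
  fun x => fstMarg (W x)

/-- `WYⁿ(D | x)` for the memoryless channel with transition matrix `WY`. -/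
def blockProb {X Y : Type*} [Fintype Y] {n : ℕ} (WY : X → Y → ℝ)
    (x : Fin n → X) (D : Set (Fin n → Y)) : ℝ :=
  ∑ y, D.indicator (fun y => ∏ i, WY (x i) (y i)) y

namespace Code

variable {X Y Z : Type*} [Fintype Y] {n : ℕ} {R₁ R₂ : ℝ}

/-- Decoding region of `m₁` at terminal `Y`. -/
def region₁ (c : Code X Y Z n R₁ R₂) (m₁ : Msg n R₁) : Set (Fin n → Y) :=
  {y | (c.decY y).1 = some m₁}

/-- Decoding region of `m₂` at terminal `Y` (message 1 may be decoded or erased). -/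
def region₂ (c : Code X Y Z n R₁ R₂) (m₂ : Msg n R₂) : Set (Fin n → Y) :=
  {y | (c.decY y).2 = some m₂}

/-- Average over a uniform pair of messages. -/
def avg (f : Msg n R₁ → Msg n R₂ → ℝ) : ℝ :=
  (∑ m₁, ∑ m₂, f m₁ m₂) / (Fintype.card (Msg n R₁) * Fintype.card (Msg n R₂))

/-- Average total (undetected or erased) error probability of message 1 at `Y`. -/
def totalErr₁ (c : Code X Y Z n R₁ R₂) (WY : X → Y → ℝ) : ℝ :=
  avg fun m₁ m₂ => blockProb WY (c.enc m₁ m₂) (c.region₁ m₁)ᶜ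

/-- Average undetected error probability of message 1 at `Y`. -/
def undetErr₁ (c : Code X Y Z n R₁ R₂) (WY : X → Y → ℝ) : ℝ :=
  avg fun m₁ m₂ => blockProb WY (c.enc m₁ m₂) (⋃ m ∈ {m | m ≠ m₁}, c.region₁ m)

/-- Average total (undetected or erased) error probability of message 2 at `Y`. -/
def totalErr₂ (c : Code X Y Z n R₁ R₂) (WY : X → Y → ℝ) : ℝ :=
  avg fun m₁ m₂ => blockProb WY (c.enc m₁ m₂) (c.region₂ m₂)ᶜ

/-- Average undetected error probability of message 2 at `Y`. -/
def undetErr₂ (c : Code X Y Z n R₁ R₂) (WY : X → Y → ℝ) : ℝ :=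
  avg fun m₁ m₂ => blockProb WY (c.enc m₁ m₂) (⋃ m ∈ {m | m ≠ m₂}, c.region₂ m)

end Code

open Classical in
/-- `(1/n) log₂ (1/p)`, with value `⊤` for `p = 0`. -/
def expo (n : ℕ) (p : ℝ) : EReal :=
  if p = 0 then ⊤ else ((1 / (n : ℝ) * Real.logb 2 (1 / p) : ℝ) : EReal)

/-! ### Superposition codebooks and the two-step erasure decoder -/

/-- A superposition codebook: cloud centers `u m₂` and satellite codewords `x m₁ m₂`. -/
structure Codebook (U X : Type*) (n : ℕ) (R₁ R₂ : ℝ) where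
  u : Msg n R₂ → Fin n → U
  x : Msg n R₁ → Msg n R₂ → Fin n → X

namespace Codebook

variable {U X Y Z : Type*} [Fintype U] [Fintype X] [Fintype Y] {n : ℕ} {R₁ R₂ : ℝ}

/-- `Î(u(m₂), x(m₁, m₂) ∧ y)`. -/
def info₁₂ (C : Codebook U X n R₁ R₂) (y : Fin n → Y) (m : Msg n R₁ × Msg n R₂) : ℝ :=
  empInfo (pairSeq (C.u m.2) (C.x m.1 m.2)) y

/-- `Î(u(m₂) ∧ y)`. -/
def info₂ (C : Codebook U X n R₁ R₂) (y : Fin n → Y) (m₂ : Msg n R₂) : ℝ :=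
  empInfo (C.u m₂) y

/-- The pair `m` passes the test of Step 1. -/
def Step₁ (C : Codebook U X n R₁ R₂) (S₁ S₂ l₁₂ : ℝ) (y : Fin n → Y)
    (m : Msg n R₁ × Msg n R₂) : Prop :=
  ∀ m', m' ≠ m →
    C.info₁₂ y m ≥ (S₁ + S₂) + l₁₂ * max (C.info₁₂ y m' - (R₁ + R₂)) 0

/-- The message `m` passes the test of Step 2. -/
def Step₂ (C : Codebook U X n R₁ R₂) (S₂ l₂ : ℝ) (y : Fin n → Y) (m : Msg n R₂) : Prop :=
  ∀ m', m' ≠ m → C.info₂ y m ≥ S₂ + l₂ * max (C.info₂ y m' - R₂) 0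

open Classical in
/-- The two-step erasure decoder with thresholds `S₁, S₂` and parameters `l₁₂, l₂`. -/
def twoStep (C : Codebook U X n R₁ R₂) (S₁ S₂ l₁₂ l₂ : ℝ) (y : Fin n → Y) :
    Option (Msg n R₁) × Option (Msg n R₂) :=
  if h : ∃! m, C.Step₁ S₁ S₂ l₁₂ y m then (some h.exists.choose.1, some h.exists.choose.2)
  else if h : ∃! m, C.Step₂ S₂ l₂ y m then (none, some h.exists.choose)
  else (none, none)

/-- The code with satellite codewords as channel inputs, the two-step decoder at terminal `Y`
and the decoder `φ` at terminal `Z`. -/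
def code (C : Codebook U X n R₁ R₂) (S₁ S₂ l₁₂ l₂ : ℝ)
    (φ : (Fin n → Z) → Option (Msg n R₂)) : Code X Y Z n R₁ R₂ where
  enc := C.x
  decY := C.twoStep S₁ S₂ l₁₂ l₂
  decZ := φ

end Codebook

/-! ### Exponents -/

section Exponents

variable {U X Y : Type*} [Fintype U] [Fintype X] [Fintype Y]

/-- The channel `(u, x) ↦ WY(· | x)`. -/
def chanUX (WY : X → Y → ℝ) : U × X → Y → ℝ := fun p => WY p.2

/-- The averaged channel `W_{Y|U}(y|u) = ∑ₓ WY(y|x) P_{X|U}(x|u)`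
(only its rows with `P_U(u) > 0` are ever used). -/
def chanU (P : U × X → ℝ) (WY : X → Y → ℝ) : U → Y → ℝ :=
  fun u y => ∑ x, WY x y * (P (u, x) / fstMarg P u)

/-- The law of `(U, Y)` under `P_{UX} × V`. -/
def jointUY (P : U × X → ℝ) (V : U × X → Y → ℝ) : U × Y → ℝ :=
  fun p => ∑ x, P (p.1, x) * V (p.1, x) p.2

/-- `J_V(R₁, R₂) = |I_V(UX ∧ Y) - R₁ - R₂|⁺`. -/
def J₁₂ (P : U × X → ℝ) (V : U × X → Y → ℝ) (R₁ R₂ : ℝ) : ℝ :=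
  max (mutualInfo (joint P V) - (R₁ + R₂)) 0

/-- `|I(U ∧ Y) - R₂|⁺` for a joint law `Q` of `(U, Y)`. -/
def J₂ (Q : U × Y → ℝ) (R₂ : ℝ) : ℝ := max (mutualInfo Q - R₂) 0

/-- Marginal modified random coding exponent `E_{r,l}(R₂)`. -/
def Er₂ (P : U × X → ℝ) (WY : X → Y → ℝ) (l R₂ : ℝ) : EReal :=
  ⨅ V : U → stdSimplex ℝ Y,
    condKL (fun u => V u) (chanU P WY) (fstMarg P) +
      ((l * J₂ (joint (fstMarg P) fun u => V u) R₂ : ℝ) : EReal)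

/-- Joint modified random coding exponent `E_{r,l}(R₁, R₂)`. -/
def Er₁₂ (P : U × X → ℝ) (WY : X → Y → ℝ) (l R₁ R₂ : ℝ) : EReal :=
  ⨅ V : U × X → stdSimplex ℝ Y,
    condKL (fun p => V p) (chanUX WY) P +
      ((l * J₁₂ P (fun p => V p) R₁ R₂ : ℝ) : EReal)

/-- Penalized modified random coding exponent `E⁻_{r,l}(R₁, R₂, R)`. -/
def ErPen (P : U × X → ℝ) (WY : X → Y → ℝ) (l R₁ R₂ R : ℝ) : EReal :=
  ⨅ V : U × X → stdSimplex ℝ Y,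
    condKL (fun p => V p) (chanUX WY) P +
      ((l * J₁₂ P (fun p => V p) R₁ R₂ - J₂ (jointUY P fun p => V p) R : ℝ) : EReal)

end Exponents

end ABC

end

/-! Random coding over permutations, with one quantity controlling all error events. Fix `u`, `x`
whose joint type approximates `P`. Cloud centers are `u ∘ π` for random permutations `π`. Satellites
are `x ∘ σ ∘ π`, with `σ` random in the stabilizer of `u`, so the joint type never changes.

For a sent pair and an output `y`, `weight` is the conditional likelihood of `y` under its own
conditional type. The channel probability equals `weight` times `2 ^ (-n D(V‖W|T))` when it is
nonzero, `V` being that conditional type (`prod_le_condLik_mul`). `score` adds exponentials of the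
competitors' empirical informations, normalized by the rates. The mean of `weight * score` is
polynomial in `n` (`sum_permBook_score_le`): `2 ^ (n Î)` is the likelihood ratio turning a type law
into a conditional law given `y`, and conditional likelihoods sum to at most the number of
conditional types (`sum_condLik_le`). Since `score` contains no thresholds, one codebook with
polynomial average serves every decoder.

Each error event forces `2 ^ (n · penalty) ≤ score` (the `score_ge_of_*` lemmas). On such an event
the channel probability is therefore at most `weight * score * 2 ^ (-n (D + penalty))`, and
`avg_blockProb_le` yields the exponent `min_V [D + penalty]` at the codebook's type. A rival in the
sent cloud is controlled only through conditional information given `u`; this causes the loss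
`|I(U∧Y) - R₂|⁺` in the penalized exponents.

Lower semicontinuity (`eventually_le_penExp`) passes from the types to `P`. The log-sum inequality
(`Er₂_le_penExp`) reduces the cloud-center exponents to the same form. Message 2 fails through a
wrong Step 1 decision, or when both steps go wrong together; hence the shape `min {·, max {·, ·}}`.
-/

noncomputable section

namespace ABC

/-! ### Counting by types and random permutations. -/

section Counting

open Classical Nat

variable {α β γ : Type*} {n : ℕ}

/-- The number of occurrences of `a` in the sequence `s`. -/
def cnt (s : Fin n → α) (a : α) : ℕ := (Finset.univ.filter fun i => s i = a).card

theorem seqType_apply (s : Fin n → α) (a : α) : seqType s a = (cnt s a : ℝ) / n := rfl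

theorem cnt_pos (s : Fin n → α) (i : Fin n) : 0 < cnt s (s i) :=
  Finset.card_pos.2 ⟨i, by simp⟩

theorem cnt_pos_iff (s : Fin n → α) (a : α) : 0 < cnt s a ↔ ∃ i, s i = a := by
  simp [cnt, Finset.card_pos, Finset.Nonempty]

theorem cnt_le (s : Fin n → α) (a : α) : cnt s a ≤ n :=
  (Finset.card_le_univ _).trans (by simp)

theorem cnt_comp_perm (s : Fin n → α) (σ : Equiv.Perm (Fin n)) (a : α) :
    cnt (s ∘ σ) a = cnt s a := by
  unfold cnt
  refine Finset.card_bij (fun i _ => σ i) ?_ ?_ ?_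
  · intro i hi; simpa using hi
  · intro i _ j _ h; exact σ.injective h
  · intro j hj; exact ⟨σ.symm j, by simpa using hj, by simp⟩

theorem seqType_comp_perm (s : Fin n → α) (σ : Equiv.Perm (Fin n)) :
    seqType (s ∘ σ) = seqType s := by
  funext a; rw [seqType_apply, seqType_apply, cnt_comp_perm]

theorem cnt_comp_injective {f : α → β} (hf : Function.Injective f) (s : Fin n → α) (a : α) :
    cnt (fun i => f (s i)) (f a) = cnt s a := by
  simp [cnt, hf.eq_iff]

/-- The likelihood of `a` given `c` under the conditional type of `a` given `c`. -/
def condLik (c : Fin n → γ) (a : Fin n → α) : ℝ :=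
  ∏ i, (cnt (pairSeq c a) (c i, a i) : ℝ) / cnt c (c i)

theorem condLik_pos (c : Fin n → γ) (a : Fin n → α) : 0 < condLik c a :=
  Finset.prod_pos fun i _ => div_pos (by exact_mod_cast cnt_pos (pairSeq c a) i)
    (by exact_mod_cast cnt_pos c i)

variable [Fintype α]

theorem sum_comp_eq_sum_cnt (s : Fin n → α) (f : α → ℝ) :
    ∑ i, f (s i) = ∑ a, (cnt s a : ℝ) * f a := by
  rw [← Finset.sum_fiberwise' Finset.univ s f]
  simp [cnt]

theorem prod_comp_eq_prod_cnt (s : Fin n → α) (f : α → ℝ) :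
    ∏ i, f (s i) = ∏ a, f a ^ cnt s a := by
  rw [← Finset.prod_fiberwise' Finset.univ s f]
  simp [cnt]

theorem sum_cnt (s : Fin n → α) : ∑ a, cnt s a = n := by
  have := sum_comp_eq_sum_cnt s (fun _ => 1)
  simp at this
  exact_mod_cast this.symm

theorem sum_cnt_pairSeq_right (c : Fin n → γ) (a : Fin n → α) (g : γ) :
    ∑ b, cnt (pairSeq c a) (g, b) = cnt c g := by
  unfold cnt
  rw [Finset.card_eq_sum_card_fiberwise (f := a) (t := Finset.univ) (by simp)]
  refine Finset.sum_congr rfl fun b _ => ?_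
  rw [Finset.filter_filter]
  simp [pairSeq]

theorem sum_cnt_pairSeq_left (c : Fin n → α) (a : Fin n → γ) (g : γ) :
    ∑ b, cnt (pairSeq c a) (b, g) = cnt a g := by
  unfold cnt
  rw [Finset.card_eq_sum_card_fiberwise (f := c) (t := Finset.univ) (by simp)]
  refine Finset.sum_congr rfl fun b _ => ?_
  rw [Finset.filter_filter]
  simp [pairSeq, and_comm]

/-- The counts of `(c, a)` are frozen while `a'` varies, so the summand is a product of probability
kernels. -/
theorem sum_prod_kernel_eq_one (c : Fin n → γ) (a : Fin n → α) :
    ∑ a' : Fin n → α, ∏ i, (cnt (pairSeq c a) (c i, a' i) : ℝ) / cnt c (c i) = 1 := by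
  have := Fintype.prod_sum fun (i : Fin n) (b : α) =>
    (cnt (pairSeq c a) (c i, b) : ℝ) / cnt c (c i)
  rw [← this]
  refine Finset.prod_eq_one fun i _ => ?_
  rw [← Finset.sum_div]
  have hs : ∑ b, (cnt (pairSeq c a) (c i, b) : ℝ) = cnt c (c i) := by
    exact_mod_cast sum_cnt_pairSeq_right c a (c i)
  rw [hs]
  exact div_self (by exact_mod_cast (cnt_pos c i).ne')

variable [Fintype γ]

theorem card_image_cnt_le (c : Fin n → γ) :
    (Finset.univ.image fun a : Fin n → α => cnt (pairSeq c a)).card ≤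
      (n + 1) ^ (Fintype.card γ * Fintype.card α) := by
  have h : (Finset.univ.image fun a : Fin n → α => cnt (pairSeq c a)) ⊆
      Fintype.piFinset fun _ : γ × α => Finset.range (n + 1) := by
    intro k hk
    obtain ⟨a, -, rfl⟩ := Finset.mem_image.1 hk
    exact Fintype.mem_piFinset.2 fun p => Finset.mem_range.2 (Nat.lt_succ_of_le (cnt_le _ _))
  refine (Finset.card_le_card h).trans (le_of_eq ?_)
  rw [Fintype.card_piFinset, Finset.prod_const, Finset.card_univ, Fintype.card_prod,
    Finset.card_range]

/-- On each joint type `condLik c` agrees with a fixed product kernel of total mass one; only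
polynomially many joint types occur. -/
theorem sum_condLik_le (c : Fin n → γ) :
    ∑ a : Fin n → α, condLik c a ≤
      ((n : ℝ) + 1) ^ (Fintype.card γ * Fintype.card α) := by
  have h1 : ∀ a : Fin n → α, condLik c a ≤
      ∑ k ∈ Finset.univ.image fun a : Fin n → α => cnt (pairSeq c a),
        ∏ i, (k (c i, a i) : ℝ) / cnt c (c i) := fun a =>
    Finset.single_le_sum (f := fun k : γ × α → ℕ => ∏ i, (k (c i, a i) : ℝ) / cnt c (c i))
      (fun k _ => Finset.prod_nonneg fun i _ => by positivity)
      (Finset.mem_image_of_mem (fun a : Fin n → α => cnt (pairSeq c a)) (Finset.mem_univ a))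
  refine (Finset.sum_le_sum fun a _ => h1 a).trans ?_
  rw [Finset.sum_comm, Finset.sum_congr rfl (g := fun _ => (1 : ℝ))]
  · rw [Finset.sum_const, nsmul_eq_mul, mul_one]
    exact_mod_cast card_image_cnt_le (α := α) c
  · intro k hk
    obtain ⟨a, -, rfl⟩ := Finset.mem_image.1 hk
    exact sum_prod_kernel_eq_one c a

/-! ### Factorial estimates -/

theorem pow_self_le_exp_mul_factorial (k : ℕ) : (k : ℝ) ^ k ≤ Real.exp k * k ! := by
  have := Real.pow_div_factorial_le_exp (k : ℝ) (by positivity) k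
  rwa [div_le_iff₀ (by positivity)] at this

theorem factorial_mul_exp_le (k : ℕ) :
    (k ! : ℝ) * Real.exp k ≤ 3 * (k + 1) * (k : ℝ) ^ k := by
  rcases Nat.eq_zero_or_pos k with rfl | hk
  · norm_num
  -- The sharper constant `e * k` makes the induction close, through `e ≤ (1 + 1/k) ^ (k + 1)`.
  suffices h : (k ! : ℝ) * Real.exp k ≤ Real.exp 1 * k * (k : ℝ) ^ k by
    refine h.trans ?_
    have := Real.exp_one_lt_d9
    gcongr
    · linarith
    · linarith
  induction k, hk using Nat.le_induction with
  | base => simp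
  | succ k hk ih =>
    have hk' : (0 : ℝ) < k := by exact_mod_cast hk
    have h1 : Real.exp 1 * (k : ℝ) ^ (k + 1) ≤ ((k : ℝ) + 1) ^ (k + 1) := by
      have h2 : 1 / ((k : ℝ) + 1) ≤ Real.log ((k + 1) / k) := by
        have := Real.one_sub_inv_le_log_of_pos (x := ((k : ℝ) + 1) / k) (by positivity)
        refine le_trans (le_of_eq ?_) this
        field_simp; ring
      have h3 : Real.exp 1 ≤ (((k : ℝ) + 1) / k) ^ (k + 1) := by
        rw [← Real.log_le_log_iff (by positivity) (by positivity), Real.log_exp, Real.log_pow]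
        push_cast
        calc (1 : ℝ) = (k + 1) * (1 / (k + 1)) := by field_simp
          _ ≤ _ := by gcongr
      rw [div_pow, le_div_iff₀ (by positivity)] at h3
      exact h3
    rw [Nat.factorial_succ]
    push_cast
    rw [Real.exp_add]
    calc ((k : ℝ) + 1) * k ! * (Real.exp k * Real.exp 1)
        = (k + 1) * Real.exp 1 * (k ! * Real.exp k) := by ring
      _ ≤ (k + 1) * Real.exp 1 * (Real.exp 1 * k * (k : ℝ) ^ k) := by gcongr
      _ = (k + 1) * Real.exp 1 * (Real.exp 1 * (k : ℝ) ^ (k + 1)) := by ring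
      _ ≤ (k + 1) * Real.exp 1 * ((k : ℝ) + 1) ^ (k + 1) := by gcongr
      _ = _ := by ring

theorem condLik_eq_prod (c : Fin n → γ) (a : Fin n → α) :
    condLik c a = (∏ p, (cnt (pairSeq c a) p : ℝ) ^ cnt (pairSeq c a) p) /
      ∏ g, (cnt c g : ℝ) ^ cnt c g := by
  rw [condLik, Finset.prod_div_distrib, ← prod_comp_eq_prod_cnt c fun g => (cnt c g : ℝ),
    ← prod_comp_eq_prod_cnt (pairSeq c a) fun p => (cnt (pairSeq c a) p : ℝ)]
  rfl

theorem prod_exp_cnt (s : Fin n → α) : ∏ a, Real.exp (cnt s a) = Real.exp n := by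
  rw [← Real.exp_sum]
  congr 1
  exact_mod_cast sum_cnt s

/-- The quotient of the two factorial products is the reciprocal of the size of the orbit of `a`
under the stabilizer of `c`. Weak Stirling bounds identify it with `condLik c a` up to a polynomial
factor. -/
theorem prod_factorial_pairSeq_le (c : Fin n → γ) (a : Fin n → α) :
    (∏ p, ((cnt (pairSeq c a) p)! : ℝ)) ≤
      (3 * ((n : ℝ) + 1)) ^ (Fintype.card γ * Fintype.card α) * condLik c a *
        ∏ g, ((cnt c g)! : ℝ) := by
  have h1 : (∏ p, ((cnt (pairSeq c a) p)! : ℝ)) * Real.exp n ≤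
      (3 * ((n : ℝ) + 1)) ^ (Fintype.card γ * Fintype.card α) *
        ∏ p, (cnt (pairSeq c a) p : ℝ) ^ cnt (pairSeq c a) p := by
    rw [← prod_exp_cnt (pairSeq c a), ← Finset.prod_mul_distrib, ← Fintype.card_prod,
      ← Finset.card_univ, ← Finset.prod_const, ← Finset.prod_mul_distrib]
    refine Finset.prod_le_prod (fun _ _ => by positivity) fun p _ => ?_
    refine (factorial_mul_exp_le _).trans ?_
    have : (cnt (pairSeq c a) p : ℝ) ≤ n := by exact_mod_cast cnt_le _ _
    gcongr
  have h2 : ∏ g, (cnt c g : ℝ) ^ cnt c g ≤ Real.exp n * ∏ g, ((cnt c g)! : ℝ) := by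
    rw [← prod_exp_cnt c, ← Finset.prod_mul_distrib]
    exact Finset.prod_le_prod (fun _ _ => by positivity) fun p _ =>
      pow_self_le_exp_mul_factorial _
  -- Absent symbols contribute `0 ^ 0 = 1`.
  have hpos : 0 < ∏ g, (cnt c g : ℝ) ^ cnt c g := Finset.prod_pos fun g _ => by
    rcases Nat.eq_zero_or_pos (cnt c g) with h | h
    · simp [h]
    · positivity
  rw [condLik_eq_prod]
  set A := ∏ p, ((cnt (pairSeq c a) p)! : ℝ)
  set B := ∏ p, (cnt (pairSeq c a) p : ℝ) ^ cnt (pairSeq c a) p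
  set K := (3 * ((n : ℝ) + 1)) ^ (Fintype.card γ * Fintype.card α)
  set D := ∏ g, (cnt c g : ℝ) ^ cnt c g
  set F := ∏ g, ((cnt c g)! : ℝ)
  have hF : 0 ≤ F := Finset.prod_nonneg fun _ _ => by positivity
  have hA : 0 ≤ A := Finset.prod_nonneg fun _ _ => by positivity
  rw [mul_div_assoc', div_mul_eq_mul_div, le_div_iff₀ hpos]
  calc A * D ≤ A * (Real.exp n * F) := by gcongr
    _ = A * Real.exp n * F := by ring
    _ ≤ K * B * F := by gcongr

/-! ### Random permutations -/

/-- The permutations of positions that fix the sequence `u`. -/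
def Stab (u : Fin n → γ) : Type := {σ : Equiv.Perm (Fin n) // u ∘ σ = u}

instance (u : Fin n → γ) : Fintype (Stab u) :=
  inferInstanceAs (Fintype {σ : Equiv.Perm (Fin n) // u ∘ σ = u})

instance (u : Fin n → γ) : Nonempty (Stab u) := ⟨⟨1, rfl⟩⟩

theorem card_stab (u : Fin n → γ) : (Fintype.card (Stab u) : ℝ) = ∏ g, ((cnt u g)! : ℝ) := by
  have h : Fintype.card (Stab u) = _ := DomMulAct.stabilizer_card u
  simp only [Fintype.card_subtype] at h
  rw [h]
  push_cast
  rfl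

/-- The set is empty or a coset of the stabilizer of `s`. -/
theorem card_perm_comp_eq_le (s s' : Fin n → γ) :
    ((Finset.univ.filter fun σ : Equiv.Perm (Fin n) => s ∘ σ = s').card : ℝ) ≤
      ∏ g, ((cnt s g)! : ℝ) := by
  rw [← card_stab]
  norm_cast
  rcases (Finset.univ.filter fun σ : Equiv.Perm (Fin n) => s ∘ σ = s').eq_empty_or_nonempty
    with h | ⟨τ, hτ⟩
  · rw [h]; simp
  · have hc : Fintype.card (Stab s) =
        (Finset.univ.filter fun σ : Equiv.Perm (Fin n) => s ∘ σ = s).card :=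
      Fintype.card_subtype _
    rw [hc]
    have hτ' : s ∘ τ = s' := by simpa using hτ
    refine Finset.card_le_card_of_injOn (fun σ => σ * τ⁻¹) ?_ ?_
    · intro σ hσ
      have hσ' : s ∘ σ = s' := by simpa using hσ
      simp only [Finset.coe_filter, Finset.mem_univ, true_and, Set.mem_ofPred_eq]
      funext i
      have := congrFun (hσ'.trans hτ'.symm) (τ⁻¹ i)
      simpa using this
    · intro σ _ σ' _ h
      simpa using h

/-- Averaging over a random permutation of `x` that fixes `u` costs only a polynomial factor
compared with the law of conditional likelihood `condLik u x` per sequence. -/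
theorem sum_stab_condLik_le {δ : Type*} [Fintype δ] (c : Fin n → δ) (u : Fin n → γ)
    (x : Fin n → α) :
    ∑ σ : Stab u, condLik c (x ∘ σ.1) ≤
      ((n : ℝ) + 1) ^ (Fintype.card δ * Fintype.card α) *
        (3 * ((n : ℝ) + 1)) ^ (Fintype.card γ * Fintype.card α) * condLik u x *
          Fintype.card (Stab u) := by
  -- A value `x'` is attained at most as often as there are permutations carrying `(u, x)` to `(u,
  -- x')`.
  have h1 : ∑ σ : Stab u, condLik c (x ∘ σ.1) ≤
      ∑ x' : Fin n → α, (∏ p, ((cnt (pairSeq u x) p)! : ℝ)) * condLik c x' := by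
    rw [← Finset.sum_fiberwise Finset.univ (fun σ : Stab u => x ∘ σ.1)]
    refine Finset.sum_le_sum fun x' _ => ?_
    rw [Finset.sum_congr rfl (g := fun _ => condLik c x')
      (fun σ hσ => by rw [(Finset.mem_filter.1 hσ).2]), Finset.sum_const, nsmul_eq_mul]
    refine mul_le_mul_of_nonneg_right ?_ (condLik_pos _ _).le
    refine le_trans ?_ (card_perm_comp_eq_le (pairSeq u x) (pairSeq u x'))
    norm_cast
    refine Finset.card_le_card_of_injOn (fun σ => σ.1) ?_ (fun σ _ σ' _ h => Subtype.ext h)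
    intro σ hσ
    have hσ' : x ∘ σ.1 = x' := by simpa using hσ
    simp only [Finset.coe_filter, Finset.mem_univ, true_and, Set.mem_ofPred_eq]
    funext i
    exact Prod.ext (congrFun σ.2 i) (congrFun hσ' i)
  refine h1.trans ?_
  rw [← Finset.mul_sum, card_stab]
  calc _ ≤ ((3 * ((n : ℝ) + 1)) ^ (Fintype.card γ * Fintype.card α) * condLik u x *
        ∏ g, ((cnt u g)! : ℝ)) * ((n : ℝ) + 1) ^ (Fintype.card δ * Fintype.card α) := by
        refine mul_le_mul (prod_factorial_pairSeq_le u x) (sum_condLik_le c)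
          (Finset.sum_nonneg fun _ _ => (condLik_pos _ _).le) ?_
        have := (condLik_pos u x).le
        positivity
    _ = _ := by ring

end Counting

/-! ### Empirical information as a likelihood ratio; channel probabilities. -/

section Identities

open Classical

variable {α β γ : Type*} {n : ℕ}

theorem cnt_pairSeq_swap (a : Fin n → α) (b : Fin n → β) (p : α) (q : β) :
    cnt (pairSeq b a) (q, p) = cnt (pairSeq a b) (p, q) :=
  cnt_comp_injective (f := Prod.swap) Prod.swap_injective (pairSeq a b) (p, q)

theorem cnt_pairSeq_right_comm (a : Fin n → α) (b : Fin n → β) (c : Fin n → γ)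
    (p : α) (q : β) (r : γ) :
    cnt (pairSeq (pairSeq a c) b) ((p, r), q) = cnt (pairSeq (pairSeq a b) c) ((p, q), r) :=
  cnt_comp_injective (f := fun t : (α × β) × γ => ((t.1.1, t.2), t.1.2))
    (fun s t h => by simp only [Prod.mk.injEq] at h; ext <;> simp [h])
    (pairSeq (pairSeq a b) c) ((p, q), r)

theorem condLik_comp_perm (c : Fin n → γ) (a : Fin n → α) (σ : Equiv.Perm (Fin n)) :
    condLik (c ∘ σ) (a ∘ σ) = condLik c a := by
  have h : pairSeq (c ∘ σ) (a ∘ σ) = pairSeq c a ∘ σ := rfl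
  unfold condLik
  simp only [h, cnt_comp_perm, Function.comp_apply]
  exact Equiv.prod_comp σ fun i => (cnt (pairSeq c a) (c i, a i) : ℝ) / cnt c (c i)

/-- The constant sequence, conditioning on which is no conditioning. -/
def unitSeq (n : ℕ) : Fin n → Unit := fun _ => ()

theorem condLik_unitSeq (a : Fin n → α) :
    condLik (unitSeq n) a = ∏ i, (cnt a (a i) : ℝ) / n := by
  unfold condLik
  refine Finset.prod_congr rfl fun i _ => ?_
  congr 2
  · exact cnt_comp_injective (f := fun b : α => ((), b)) (Prod.mk_right_injective ()) a (a i)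
  · simp [cnt, unitSeq]

variable [Fintype β]

theorem fstMarg_seqType (a : Fin n → α) (b : Fin n → β) :
    fstMarg (seqType (pairSeq a b)) = seqType a := by
  funext p
  simp only [fstMarg, seqType_apply, ← Finset.sum_div]
  rw [← sum_cnt_pairSeq_right a b p]
  push_cast; rfl

theorem sndMarg_seqType (a : Fin n → β) (b : Fin n → α) :
    sndMarg (seqType (pairSeq a b)) = seqType b := by
  funext p
  simp only [sndMarg, seqType_apply, ← Finset.sum_div]
  rw [← sum_cnt_pairSeq_left a b p]
  push_cast; rfl

/-- The conditional type of `y` given `s`, completed to a stochastic matrix. -/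
theorem exists_condType (hn : 0 < n) (s : Fin n → α) (y : Fin n → β) :
    ∃ V : α → stdSimplex ℝ β,
      (∀ a b, seqType s a * V a b = seqType (pairSeq s y) (a, b)) ∧
      (∀ i, (V (s i) (y i) : ℝ) = (cnt (pairSeq s y) (s i, y i) : ℝ) / cnt s (s i)) := by
  have hsum : ∀ a, cnt s a ≠ 0 →
      (fun b => (cnt (pairSeq s y) (a, b) : ℝ) / cnt s a) ∈ stdSimplex ℝ β := by
    intro a ha
    refine ⟨fun b => by positivity, ?_⟩
    rw [← Finset.sum_div]
    have : ∑ b, (cnt (pairSeq s y) (a, b) : ℝ) = cnt s a := by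
      exact_mod_cast sum_cnt_pairSeq_right s y a
    rw [this]
    exact div_self (by exact_mod_cast ha)
  -- Rows of symbols absent from `s` are irrelevant and filled with a point mass; `hn` supplies a
  -- letter of `y` for it.
  refine ⟨fun a => if h : cnt s a ≠ 0 then ⟨_, hsum a h⟩
    else ⟨_, single_mem_stdSimplex ℝ (y ⟨0, hn⟩)⟩, ?_, ?_⟩
  · intro a b
    by_cases h : cnt s a = 0
    · have h2 : cnt (pairSeq s y) (a, b) = 0 := by
        by_contra h3
        obtain ⟨i, hi⟩ := (cnt_pos_iff _ _).1 (Nat.pos_of_ne_zero h3)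
        have h4 : s i = a := congrArg Prod.fst hi
        exact (h4 ▸ cnt_pos s i).ne' h
      simp [seqType_apply, h, h2]
    · have h' : (cnt s a : ℝ) ≠ 0 := by exact_mod_cast h
      have hn' : (n : ℝ) ≠ 0 := by positivity
      simp only [seqType_apply, ne_eq, h, not_false_eq_true]
      change (cnt s a : ℝ) / n * ((cnt (pairSeq s y) (a, b) : ℝ) / cnt s a) = _
      field_simp
  · intro i
    have h := (cnt_pos s i).ne'
    simp only [ne_eq, h, not_false_eq_true, dif_pos]
    rfl

variable [Fintype α] [Fintype γ]

/-- Written over positions instead of letters, the product involves only positive counts, so the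
likelihood-ratio identities below can be checked factor by factor. -/
theorem two_rpow_mul_empInfo (hn : 0 < n) (a : Fin n → α) (b : Fin n → β) :
    (2 : ℝ) ^ ((n : ℝ) * empInfo a b) =
      ∏ i, (cnt (pairSeq a b) (a i, b i) : ℝ) * n / (cnt a (a i) * cnt b (b i)) := by
  have hn' : (n : ℝ) ≠ 0 := by positivity
  have ha : ∀ i, (0 : ℝ) < cnt a (a i) := fun i => by exact_mod_cast cnt_pos a i
  have hb : ∀ i, (0 : ℝ) < cnt b (b i) := fun i => by exact_mod_cast cnt_pos b i
  have hab : ∀ i, (0 : ℝ) < cnt (pairSeq a b) (a i, b i) := fun i => by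
    exact_mod_cast cnt_pos (pairSeq a b) i
  have hpos : ∀ i, 0 < (cnt (pairSeq a b) (a i, b i) : ℝ) * n / (cnt a (a i) * cnt b (b i)) :=
    fun i => by have := ha i; have := hb i; have := hab i; positivity
  have key : (n : ℝ) * empInfo a b = Real.logb 2
      (∏ i, (cnt (pairSeq a b) (a i, b i) : ℝ) * n / (cnt a (a i) * cnt b (b i))) := by
    rw [Real.logb_prod _ _ fun i _ => (hpos i).ne']
    have := sum_comp_eq_sum_cnt (pairSeq a b) fun p =>
      Real.logb 2 ((cnt (pairSeq a b) p : ℝ) * n / (cnt a p.1 * cnt b p.2))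
    simp only [pairSeq] at this
    refine Eq.trans ?_ this.symm
    rw [Fintype.sum_prod_type, empInfo, mutualInfo, fstMarg_seqType, sndMarg_seqType,
      Finset.mul_sum]
    refine Finset.sum_congr rfl fun p _ => ?_
    rw [Finset.mul_sum]
    refine Finset.sum_congr rfl fun q _ => ?_
    simp only [seqType_apply]
    rw [← mul_assoc, mul_div_cancel₀ _ hn']
    congr 2
    rw [div_mul_div_comm, div_div_div_eq, ← mul_assoc, ← div_mul_div_comm,
      mul_div_cancel_right₀ _ hn', mul_div_assoc]
  rw [key, Real.rpow_logb (by norm_num) (by norm_num) (Finset.prod_pos fun i _ => hpos i)]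

theorem two_rpow_empInfo_mul_condLik (hn : 0 < n) (a : Fin n → α) (b : Fin n → β) :
    (2 : ℝ) ^ ((n : ℝ) * empInfo a b) * condLik (unitSeq n) a = condLik b a := by
  rw [two_rpow_mul_empInfo hn, condLik_unitSeq, condLik, ← Finset.prod_mul_distrib]
  refine Finset.prod_congr rfl fun i _ => ?_
  have h1 : (cnt a (a i) : ℝ) ≠ 0 := by exact_mod_cast (cnt_pos a i).ne'
  have h2 : (cnt b (b i) : ℝ) ≠ 0 := by exact_mod_cast (cnt_pos b i).ne'
  rw [cnt_pairSeq_swap]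
  field_simp

/-- By the chain rule the exponent is the empirical conditional information of `x` and `y` given
`u`; it tilts the law of `x` given `u` into the law given `(u, y)`. -/
theorem two_rpow_empInfo_sub_mul_condLik (hn : 0 < n) (u : Fin n → γ) (x : Fin n → α)
    (y : Fin n → β) :
    (2 : ℝ) ^ ((n : ℝ) * (empInfo (pairSeq u x) y - empInfo u y)) * condLik u x =
      condLik (pairSeq u y) x := by
  rw [mul_sub, Real.rpow_sub (by norm_num), two_rpow_mul_empInfo hn, two_rpow_mul_empInfo hn,
    condLik, condLik, ← Finset.prod_div_distrib, ← Finset.prod_mul_distrib]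
  refine Finset.prod_congr rfl fun i _ => ?_
  have h1 : (cnt u (u i) : ℝ) ≠ 0 := by exact_mod_cast (cnt_pos u i).ne'
  have h2 : (cnt y (y i) : ℝ) ≠ 0 := by exact_mod_cast (cnt_pos y i).ne'
  have h3 : (cnt (pairSeq u x) (u i, x i) : ℝ) ≠ 0 := by
    exact_mod_cast (cnt_pos (pairSeq u x) i).ne'
  have h4 : (cnt (pairSeq u y) (u i, y i) : ℝ) ≠ 0 := by
    exact_mod_cast (cnt_pos (pairSeq u y) i).ne'
  have h5 : cnt (pairSeq (pairSeq u y) x) (pairSeq u y i, x i) =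
      cnt (pairSeq (pairSeq u x) y) (pairSeq u x i, y i) :=
    cnt_pairSeq_right_comm u x y (u i) (x i) (y i)
  rw [h5]
  simp only [show pairSeq u x i = (u i, x i) from rfl, show pairSeq u y i = (u i, y i) from rfl]
  field_simp

theorem empInfo_comp_perm (a : Fin n → α) (b : Fin n → β) (σ : Equiv.Perm (Fin n)) :
    empInfo (a ∘ σ) (b ∘ σ) = empInfo a b := by
  have h : pairSeq (a ∘ σ) (b ∘ σ) = pairSeq a b ∘ σ := rfl
  rw [empInfo, h, seqType_comp_perm, empInfo]

theorem empInfo_comp_perm_left (a : Fin n → α) (b : Fin n → β) (σ : Equiv.Perm (Fin n)) :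
    empInfo (a ∘ σ) b = empInfo a (b ∘ σ.symm) := by
  rw [← empInfo_comp_perm a (b ∘ σ.symm) σ]
  congr 1
  funext i; simp

/-- This is `sum_stab_condLik_le` for a constant conditioning sequence, whose stabilizer is the full
permutation group; the permutation-invariant factor `condLik (unitSeq n) a` cancels. -/
theorem sum_perm_two_rpow_empInfo_le (hn : 0 < n) (a : Fin n → α) (y : Fin n → β) :
    ∑ π : Equiv.Perm (Fin n), (2 : ℝ) ^ ((n : ℝ) * empInfo (a ∘ π) y) ≤
      (3 * ((n : ℝ) + 1)) ^ (Fintype.card β * Fintype.card α + Fintype.card α) *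
        Fintype.card (Equiv.Perm (Fin n)) := by
  have hL := condLik_pos (unitSeq n) a
  let e : Stab (unitSeq n) ≃ Equiv.Perm (Fin n) := Equiv.subtypeUnivEquiv fun _ => rfl
  have h := sum_stab_condLik_le y (unitSeq n) a
  rw [Fintype.card_congr e, Fintype.card_unit, one_mul] at h
  have h2 : ∑ σ : Stab (unitSeq n), condLik y (a ∘ σ.1) =
      (∑ π : Equiv.Perm (Fin n), (2 : ℝ) ^ ((n : ℝ) * empInfo (a ∘ π) y)) *
        condLik (unitSeq n) a := by
    rw [Finset.sum_mul]
    refine Fintype.sum_equiv e _ _ fun σ => ?_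
    have h3 : condLik (unitSeq n) (a ∘ σ.1) = condLik (unitSeq n) a :=
      condLik_comp_perm (unitSeq n) a σ.1
    rw [← two_rpow_empInfo_mul_condLik hn, h3]
    rfl
  rw [h2] at h
  have h4 : ((n : ℝ) + 1) ^ (Fintype.card β * Fintype.card α) ≤
      (3 * ((n : ℝ) + 1)) ^ (Fintype.card β * Fintype.card α) := by
    gcongr
    have : (0 : ℝ) ≤ n := by positivity
    linarith
  refine le_of_mul_le_mul_right (h.trans ?_) hL
  rw [pow_add]
  calc _ ≤ (3 * ((n : ℝ) + 1)) ^ (Fintype.card β * Fintype.card α) *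
        (3 * ((n : ℝ) + 1)) ^ (Fintype.card α) * condLik (unitSeq n) a *
        (Fintype.card (Equiv.Perm (Fin n)) : ℝ) := by gcongr
    _ = _ := by ring

/-- Moving `π` over to `y` leaves a sum of likelihoods conditioned on the fixed sequence `(u, y ∘
π⁻¹)`, and `condLik u x` cancels. -/
theorem sum_stab_two_rpow_empInfo_le (hn : 0 < n) (u : Fin n → γ) (x : Fin n → α)
    (y : Fin n → β) (π : Equiv.Perm (Fin n)) :
    ∑ σ : Stab u, (2 : ℝ) ^ ((n : ℝ) * (empInfo (pairSeq (u ∘ π) ((x ∘ σ.1) ∘ π)) y -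
        empInfo (u ∘ π) y)) ≤
      (3 * ((n : ℝ) + 1)) ^ (Fintype.card γ * Fintype.card β * Fintype.card α +
        Fintype.card γ * Fintype.card α) * Fintype.card (Stab u) := by
  have hL := condLik_pos u x
  have h := sum_stab_condLik_le (pairSeq u (y ∘ π.symm)) u x
  have h2 : ∑ σ : Stab u, condLik (pairSeq u (y ∘ π.symm)) (x ∘ σ.1) =
      (∑ σ : Stab u, (2 : ℝ) ^ ((n : ℝ) *
        (empInfo (pairSeq (u ∘ π) ((x ∘ σ.1) ∘ π)) y - empInfo (u ∘ π) y))) *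
        condLik u x := by
    rw [Finset.sum_mul]
    refine Finset.sum_congr rfl fun σ _ => ?_
    have h3 : condLik u (x ∘ σ.1) = condLik u x := by
      have h4 := condLik_comp_perm u x σ.1
      rwa [σ.2] at h4
    rw [← two_rpow_empInfo_sub_mul_condLik hn, h3, empInfo_comp_perm_left u,
      ← empInfo_comp_perm_left (pairSeq u (x ∘ σ.1))]
    rfl
  rw [h2, Fintype.card_prod] at h
  have h4 : ((n : ℝ) + 1) ^ (Fintype.card γ * Fintype.card β * Fintype.card α) ≤
      (3 * ((n : ℝ) + 1)) ^ (Fintype.card γ * Fintype.card β * Fintype.card α) := by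
    gcongr
    have : (0 : ℝ) ≤ n := by positivity
    linarith
  refine le_of_mul_le_mul_right (h.trans ?_) hL
  rw [pow_add]
  calc _ ≤ (3 * ((n : ℝ) + 1)) ^ (Fintype.card γ * Fintype.card β * Fintype.card α) *
        (3 * ((n : ℝ) + 1)) ^ (Fintype.card γ * Fintype.card α) * condLik u x *
        (Fintype.card (Stab u) : ℝ) := by gcongr
    _ = _ := by ring

/-! ### Channel probabilities and conditional divergence -/

/-- The channel probability of a sequence is its conditional likelihood times `2 ^ (-n D)`. -/
theorem prod_le_condLik_mul (hn : 0 < n) (s : Fin n → α) (y : Fin n → β)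
    (W : α → β → ℝ) (hW : ∀ a b, 0 ≤ W a b) (V : α → stdSimplex ℝ β)
    (hV : ∀ a b, seqType s a * V a b = seqType (pairSeq s y) (a, b))
    (hV' : ∀ i, (V (s i) (y i) : ℝ) = (cnt (pairSeq s y) (s i, y i) : ℝ) / cnt s (s i))
    (E G : ℝ) (hE : (E : EReal) ≤ condKL (fun a => V a) W (seqType s) + (G : EReal)) :
    ∏ i, W (s i) (y i) ≤ condLik s y * (2 : ℝ) ^ (-((n : ℝ) * (E - G))) := by
  have hn' : (n : ℝ) ≠ 0 := by positivity
  have hlik : condLik s y = ∏ i, (V (s i) (y i) : ℝ) :=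
    Finset.prod_congr rfl fun i _ => (hV' i).symm
  have hVpos : ∀ i, (0 : ℝ) < V (s i) (y i) := fun i => by
    rw [hV' i]
    exact div_pos (by exact_mod_cast cnt_pos (pairSeq s y) i) (by exact_mod_cast cnt_pos s i)
  -- A vanishing channel probability makes the bound trivial; otherwise `V` is absolutely continuous
  -- with respect to `W` and the divergence is finite.
  by_cases h0 : ∃ i, W (s i) (y i) = 0
  · obtain ⟨i, hi⟩ := h0
    rw [Finset.prod_eq_zero (Finset.mem_univ i) hi]
    exact mul_nonneg (condLik_pos s y).le (by positivity)
  have h0' : ∀ i, 0 < W (s i) (y i) := fun i =>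
    lt_of_le_of_ne (hW _ _) fun h => h0 ⟨i, h.symm⟩
  have habs : ∀ a b, seqType s a ≠ 0 → W a b = 0 → ((V a : β → ℝ)) b = 0 := by
    intro a b ha hab
    by_contra hne
    have h1 : seqType (pairSeq s y) (a, b) ≠ 0 := by
      rw [← hV a b]; exact mul_ne_zero ha hne
    have h2 : cnt (pairSeq s y) (a, b) ≠ 0 := fun h => h1 (by simp [seqType_apply, h])
    obtain ⟨i, hi⟩ := (cnt_pos_iff _ _).1 (Nat.pos_of_ne_zero h2)
    have h3 : s i = a := congrArg Prod.fst hi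
    have h4 : y i = b := congrArg Prod.snd hi
    exact (h0' i).ne' (by rw [h3, h4, hab])
  rw [condKL, if_pos habs, ← EReal.coe_add, EReal.coe_le_coe_iff] at hE
  have hsum : (n : ℝ) * ∑ a, seqType s a * ∑ b, (V a b : ℝ) * Real.logb 2 (V a b / W a b) =
      ∑ i, Real.logb 2 ((V (s i) (y i) : ℝ) / W (s i) (y i)) := by
    have := sum_comp_eq_sum_cnt (pairSeq s y) fun p =>
      Real.logb 2 ((V p.1 p.2 : ℝ) / W p.1 p.2)
    simp only [pairSeq] at this
    refine Eq.trans ?_ this.symm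
    rw [Fintype.sum_prod_type, Finset.mul_sum]
    refine Finset.sum_congr rfl fun a _ => ?_
    rw [Finset.mul_sum, Finset.mul_sum]
    refine Finset.sum_congr rfl fun b _ => ?_
    rw [← mul_assoc (seqType s a), hV, ← mul_assoc, seqType_apply, mul_div_cancel₀ _ hn']
  have hW2 : ∏ i, W (s i) (y i) =
      condLik s y * (2 : ℝ) ^ (-∑ i, Real.logb 2 ((V (s i) (y i) : ℝ) / W (s i) (y i))) := by
    rw [hlik, ← Finset.sum_neg_distrib, Real.rpow_sum_of_pos (by norm_num),
      ← Finset.prod_mul_distrib]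
    refine Finset.prod_congr rfl fun i _ => ?_
    rw [Real.rpow_neg (by norm_num), Real.rpow_logb (by norm_num) (by norm_num)
      (div_pos (hVpos i) (h0' i))]
    have := (hVpos i).ne'
    field_simp
  rw [hW2, ← hsum]
  have := (condLik_pos s y).le
  gcongr
  · norm_num
  · linarith

end Identities

/-! ### Averages over independent coordinates. -/

section Averaging

/-- To bound an average over all functions it suffices to average over one coordinate. -/
theorem sum_pi_le_of_sum_update_le {ι Ω : Type*} [Fintype ι] [DecidableEq ι] [Fintype Ω]
    [Nonempty Ω]
    (F : (ι → Ω) → ℝ) (j : ι) (K : ℝ)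
    (h : ∀ f, ∑ b, F (Function.update f j b) ≤ K * Fintype.card Ω) :
    ∑ f, F f ≤ K * Fintype.card (ι → Ω) := by
  let e := Equiv.funSplitAt j Ω
  obtain ⟨b₀⟩ := ‹Nonempty Ω›
  have hu : ∀ r b, Function.update (e.symm (b₀, r)) j b = e.symm (b, r) := by
    intro r b
    funext i
    by_cases hi : i = j
    · subst hi; simp [e]
    · simp [e, hi]
  rw [← Equiv.sum_comp e.symm F, Fintype.sum_prod_type_right]
  have hle : ∀ r, ∑ b, F (e.symm (b, r)) ≤ K * Fintype.card Ω := fun r => by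
    simpa only [hu] using h (e.symm (b₀, r))
  refine (Finset.sum_le_sum fun r _ => hle r).trans (le_of_eq ?_)
  rw [Finset.sum_const, Finset.card_univ, nsmul_eq_mul, Fintype.card_congr e, Fintype.card_prod]
  push_cast
  ring

/-- Expresses independence: the output weight `L` does not depend on the resampled competitor `b`.
-/
theorem sum_sum_mul_le {κ Ω : Type*} [Fintype κ] [Fintype Ω] (L : κ → ℝ) (g : Ω → κ → ℝ)
    {A B c : ℝ} (hL : ∀ y, 0 ≤ L y) (hA : ∑ y, L y ≤ A) (hBc : 0 ≤ B * c)
    (hg : ∀ y, ∑ b, g b y ≤ B * c) :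
    ∑ b, ∑ y, L y * g b y ≤ A * B * c := by
  rw [Finset.sum_comm]
  calc ∑ y, ∑ b, L y * g b y = ∑ y, L y * ∑ b, g b y := by simp only [Finset.mul_sum]
    _ ≤ ∑ y, L y * (B * c) := Finset.sum_le_sum fun y _ =>
        mul_le_mul_of_nonneg_left (hg y) (hL y)
    _ = (∑ y, L y) * (B * c) := by rw [Finset.sum_mul]
    _ ≤ A * (B * c) := mul_le_mul_of_nonneg_right hA hBc
    _ = _ := by ring

end Averaging

/-! ### The random superposition code and its expected score. -/

section RandomCode

open Classical

variable {U X Y : Type*} {n : ℕ} {R₁ R₂ : ℝ}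

theorem card_msg_mul_le (n : ℕ) {R : ℝ} (hR : 0 ≤ R) :
    (Fintype.card (Msg n R) : ℝ) * (2 : ℝ) ^ (-((n : ℝ) * R)) ≤ 2 := by
  have h1 : (1 : ℝ) ≤ (2 : ℝ) ^ ((n : ℝ) * R) :=
    Real.one_le_rpow (by norm_num) (by positivity)
  have h2 : (Fintype.card (Msg n R) : ℝ) ≤ 2 * (2 : ℝ) ^ ((n : ℝ) * R) := by
    rw [Fintype.card_fin]
    have := (Nat.ceil_lt_add_one (a := (2 : ℝ) ^ ((n : ℝ) * R)) (by positivity)).le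
    linarith
  rw [Real.rpow_neg (by norm_num), ← div_eq_mul_inv, div_le_iff₀ (by positivity)]
  exact h2

/-- The codebook obtained from `(u, x)` by permuting the positions of `u` and `x` together by
`π m₂` after permuting those of `x` by `σ (m₁, m₂)`, which fixes `u`. -/
def permBook (u : Fin n → U) (x : Fin n → X) (π : Msg n R₂ → Equiv.Perm (Fin n))
    (σ : Msg n R₁ × Msg n R₂ → Stab u) : Codebook U X n R₁ R₂ where
  u m₂ := u ∘ π m₂
  x m₁ m₂ := (x ∘ (σ (m₁, m₂)).1) ∘ π m₂

/-- As `σ` fixes `u`, both coordinates undergo the same permutation. -/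
theorem seqType_permBook (u : Fin n → U) (x : Fin n → X) (π : Msg n R₂ → Equiv.Perm (Fin n))
    (σ : Msg n R₁ × Msg n R₂ → Stab u) (m₁ : Msg n R₁) (m₂ : Msg n R₂) :
    seqType (pairSeq ((permBook u x π σ).u m₂) ((permBook u x π σ).x m₁ m₂)) =
      seqType (pairSeq u x) := by
  have h : pairSeq ((permBook u x π σ).u m₂) ((permBook u x π σ).x m₁ m₂) =
      (pairSeq u x ∘ (σ (m₁, m₂)).1) ∘ π m₂ := by
    funext i
    exact Prod.ext (congrFun (σ (m₁, m₂)).2 (π m₂ i)).symm rfl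
  rw [h, seqType_comp_perm, seqType_comp_perm]

namespace Codebook

/-- The likelihood weight of `y` when `(m₁, m₂)` is sent. -/
def weight (C : Codebook U X n R₁ R₂) (m₁ : Msg n R₁) (m₂ : Msg n R₂) (y : Fin n → Y) : ℝ :=
  condLik (pairSeq (C.u m₂) (C.x m₁ m₂)) y

theorem weight_pos (C : Codebook U X n R₁ R₂) (m₁ : Msg n R₁) (m₂ : Msg n R₂) (y : Fin n → Y) :
    0 < C.weight m₁ m₂ y := condLik_pos _ _

variable [Fintype U] [Fintype X] [Fintype Y]

/-- Total strength of the competitors of `(m₁, m₂)` at the channel output `y`: pairs from other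
clouds, satellites in the same cloud, and other cloud centers. -/
def score (C : Codebook U X n R₁ R₂) (m₁ : Msg n R₁) (m₂ : Msg n R₂) (y : Fin n → Y) : ℝ :=
  1 + (∑ m : Msg n R₁ × Msg n R₂, if m.2 ≠ m₂ then
      (2 : ℝ) ^ ((n : ℝ) * (C.info₁₂ y m - (R₁ + R₂))) else 0) +
    (∑ m : Msg n R₁, if m ≠ m₁ then
      (2 : ℝ) ^ ((n : ℝ) * (C.info₁₂ y (m, m₂) - C.info₂ y m₂ - R₁)) else 0) +
    ∑ m : Msg n R₂, if m ≠ m₂ then (2 : ℝ) ^ ((n : ℝ) * (C.info₂ y m - R₂)) else 0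

theorem sum_weight_le (C : Codebook U X n R₁ R₂) (m₁ : Msg n R₁) (m₂ : Msg n R₂) :
    ∑ y : Fin n → Y, C.weight m₁ m₂ y ≤
      ((n : ℝ) + 1) ^ (Fintype.card U * Fintype.card X * Fintype.card Y) := by
  have := sum_condLik_le (α := Y) (pairSeq (C.u m₂) (C.x m₁ m₂))
  rwa [Fintype.card_prod] at this

end Codebook

variable [Fintype U] [Fintype X] [Fintype Y]

/-- A degree that dominates all polynomial factors of the random coding argument. -/
def polyDeg (U X Y : Type*) [Fintype U] [Fintype X] [Fintype Y] : ℕ :=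
  Fintype.card U * Fintype.card X * Fintype.card Y + Fintype.card U * Fintype.card X +
    Fintype.card U * Fintype.card Y + Fintype.card U

/-- The common polynomial factor. -/
def polyFactor (U X Y : Type*) [Fintype U] [Fintype X] [Fintype Y] (n : ℕ) : ℝ :=
  (3 * ((n : ℝ) + 1)) ^ polyDeg U X Y

theorem polyFactor_pos (n : ℕ) : 0 < polyFactor U X Y n := by unfold polyFactor; positivity

theorem pow_le_polyFactor {d : ℕ} (hd : d ≤ polyDeg U X Y) :
    (3 * ((n : ℝ) + 1)) ^ d ≤ polyFactor U X Y n :=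
  pow_le_pow_right₀ (by have : (0 : ℝ) ≤ n := by positivity
                        linarith) hd

theorem sum_weight_le_polyFactor (C : Codebook U X n R₁ R₂) (m₁ : Msg n R₁) (m₂ : Msg n R₂) :
    ∑ y : Fin n → Y, C.weight m₁ m₂ y ≤ polyFactor U X Y n := by
  refine (C.sum_weight_le m₁ m₂).trans (le_trans ?_
    (pow_le_polyFactor (d := Fintype.card U * Fintype.card X * Fintype.card Y) ?_))
  · gcongr
    have : (0 : ℝ) ≤ n := by positivity
    linarith
  · unfold polyDeg; omega

variable (u : Fin n → U) (x : Fin n → X)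

/-- Only the permutation of the competing cloud is resampled; the sent pair lies in another cloud,
so its weight stays fixed. -/
theorem sum_perm_weight_mul_info₁₂_le (hn : 0 < n) (σ : Msg n R₁ × Msg n R₂ → Stab u)
    (m₁ : Msg n R₁) (m₂ : Msg n R₂) (m : Msg n R₁ × Msg n R₂) (hm : m.2 ≠ m₂) :
    ∑ π : Msg n R₂ → Equiv.Perm (Fin n), ∑ y : Fin n → Y,
      (permBook u x π σ).weight m₁ m₂ y *
        (2 : ℝ) ^ ((n : ℝ) * (permBook u x π σ).info₁₂ y m) ≤
      polyFactor U X Y n * polyFactor U X Y n *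
        Fintype.card (Msg n R₂ → Equiv.Perm (Fin n)) := by
  refine sum_pi_le_of_sum_update_le _ m.2 _ fun π => ?_
  have hw : ∀ b (y : Fin n → Y), (permBook u x (Function.update π m.2 b) σ).weight m₁ m₂ y =
      (permBook u x π σ).weight m₁ m₂ y := by
    intro b y
    simp [Codebook.weight, permBook, Function.update_of_ne hm.symm]
  simp only [hw]
  refine sum_sum_mul_le _ _ (fun y => ((permBook u x π σ).weight_pos m₁ m₂ y).le)
    (sum_weight_le_polyFactor _ _ _)
    (mul_nonneg (polyFactor_pos n).le (Nat.cast_nonneg _)) fun y => ?_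
  have h := sum_perm_two_rpow_empInfo_le hn (pairSeq u (x ∘ (σ (m.1, m.2)).1)) y
  refine le_trans (le_of_eq ?_) (h.trans (mul_le_mul_of_nonneg_right
    (pow_le_polyFactor ?_) (Nat.cast_nonneg _)))
  · refine Finset.sum_congr rfl fun b _ => ?_
    simp only [Codebook.info₁₂, permBook, Function.update_self]
    rfl
  · rw [Fintype.card_prod]
    unfold polyDeg
    have : Fintype.card Y * (Fintype.card U * Fintype.card X) =
      Fintype.card U * Fintype.card X * Fintype.card Y := by ring
    omega

theorem sum_perm_weight_mul_info₂_le (hn : 0 < n) (σ : Msg n R₁ × Msg n R₂ → Stab u)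
    (m₁ : Msg n R₁) (m₂ m : Msg n R₂) (hm : m ≠ m₂) :
    ∑ π : Msg n R₂ → Equiv.Perm (Fin n), ∑ y : Fin n → Y,
      (permBook u x π σ).weight m₁ m₂ y *
        (2 : ℝ) ^ ((n : ℝ) * (permBook u x π σ).info₂ y m) ≤
      polyFactor U X Y n * polyFactor U X Y n *
        Fintype.card (Msg n R₂ → Equiv.Perm (Fin n)) := by
  refine sum_pi_le_of_sum_update_le _ m _ fun π => ?_
  have hw : ∀ b (y : Fin n → Y), (permBook u x (Function.update π m b) σ).weight m₁ m₂ y =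
      (permBook u x π σ).weight m₁ m₂ y := by
    intro b y
    simp [Codebook.weight, permBook, Function.update_of_ne hm.symm]
  simp only [hw]
  refine sum_sum_mul_le _ _ (fun y => ((permBook u x π σ).weight_pos m₁ m₂ y).le)
    (sum_weight_le_polyFactor _ _ _)
    (mul_nonneg (polyFactor_pos n).le (Nat.cast_nonneg _)) fun y => ?_
  have h := sum_perm_two_rpow_empInfo_le hn u y
  refine le_trans (le_of_eq ?_) (h.trans (mul_le_mul_of_nonneg_right
    (pow_le_polyFactor ?_) (Nat.cast_nonneg _)))
  · refine Finset.sum_congr rfl fun b _ => ?_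
    simp only [Codebook.info₂, permBook, Function.update_self]
  · unfold polyDeg
    have : Fintype.card Y * Fintype.card U = Fintype.card U * Fintype.card Y := by ring
    omega

/-- A satellite of the sent cloud shares its center with the sent word. Only its stabilizer element
can be resampled, so only conditional information is controlled. -/
theorem sum_stab_weight_mul_info_le (hn : 0 < n) (π : Msg n R₂ → Equiv.Perm (Fin n))
    (m₁ m : Msg n R₁) (m₂ : Msg n R₂) (hm : m ≠ m₁) :
    ∑ σ : Msg n R₁ × Msg n R₂ → Stab u, ∑ y : Fin n → Y,
      (permBook u x π σ).weight m₁ m₂ y *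
        (2 : ℝ) ^ ((n : ℝ) * ((permBook u x π σ).info₁₂ y (m, m₂) -
          (permBook u x π σ).info₂ y m₂)) ≤
      polyFactor U X Y n * polyFactor U X Y n *
        Fintype.card (Msg n R₁ × Msg n R₂ → Stab u) := by
  refine sum_pi_le_of_sum_update_le _ (m, m₂) _ fun σ => ?_
  have hne : ((m₁, m₂) : Msg n R₁ × Msg n R₂) ≠ (m, m₂) := fun h => hm (congrArg Prod.fst h).symm
  have hw : ∀ b (y : Fin n → Y), (permBook u x π (Function.update σ (m, m₂) b)).weight m₁ m₂ y =
      (permBook u x π σ).weight m₁ m₂ y := by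
    intro b y
    simp only [Codebook.weight, permBook, Function.update_of_ne hne]
  simp only [hw]
  refine sum_sum_mul_le _ _ (fun y => ((permBook u x π σ).weight_pos m₁ m₂ y).le)
    (sum_weight_le_polyFactor _ _ _)
    (mul_nonneg (polyFactor_pos n).le (Nat.cast_nonneg _)) fun y => ?_
  have h := sum_stab_two_rpow_empInfo_le hn u x y (π m₂)
  refine le_trans (le_of_eq ?_) (h.trans (mul_le_mul_of_nonneg_right
    (pow_le_polyFactor ?_) (Nat.cast_nonneg _)))
  · refine Finset.sum_congr rfl fun b _ => ?_
    simp only [Codebook.info₁₂, Codebook.info₂, permBook, Function.update_self]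
  · unfold polyDeg
    have : Fintype.card U * Fintype.card Y * Fintype.card X =
      Fintype.card U * Fintype.card X * Fintype.card Y := by ring
    omega

theorem sum_ite_const_mul_le {ι Ω : Type*} [Fintype ι] [Fintype Ω] (p : ι → Prop)
    [DecidablePred p] (f : ι → Ω → ℝ) (κ K : ℝ) (hκ : 0 ≤ κ) (hK : 0 ≤ K)
    (hf : ∀ i, p i → ∑ ω, f i ω ≤ K) :
    ∑ ω, ∑ i, (if p i then κ * f i ω else 0) ≤ (Fintype.card ι * κ) * K := by
  rw [Finset.sum_comm]
  have : ∀ i, ∑ ω, (if p i then κ * f i ω else 0) ≤ κ * K := by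
    intro i
    by_cases hi : p i
    · simp only [hi, if_true, ← Finset.mul_sum]
      exact mul_le_mul_of_nonneg_left (hf i hi) hκ
    · simp only [hi, if_false, Finset.sum_const_zero]
      positivity
  refine (Finset.sum_le_sum fun i _ => this i).trans (le_of_eq ?_)
  rw [Finset.sum_const, Finset.card_univ, nsmul_eq_mul, mul_assoc]

theorem weight_mul_score_eq (C : Codebook U X n R₁ R₂) (m₁ : Msg n R₁) (m₂ : Msg n R₂) :
    ∑ y : Fin n → Y, C.weight m₁ m₂ y * C.score m₁ m₂ y =
      (∑ y : Fin n → Y, C.weight m₁ m₂ y) +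
      (∑ m : Msg n R₁ × Msg n R₂, if m.2 ≠ m₂ then
        (2 : ℝ) ^ (-((n : ℝ) * (R₁ + R₂))) * ∑ y : Fin n → Y, C.weight m₁ m₂ y *
          (2 : ℝ) ^ ((n : ℝ) * C.info₁₂ y m) else 0) +
      (∑ m : Msg n R₁, if m ≠ m₁ then
        (2 : ℝ) ^ (-((n : ℝ) * R₁)) * ∑ y : Fin n → Y, C.weight m₁ m₂ y *
          (2 : ℝ) ^ ((n : ℝ) * (C.info₁₂ y (m, m₂) - C.info₂ y m₂)) else 0) +
      ∑ m : Msg n R₂, if m ≠ m₂ then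
        (2 : ℝ) ^ (-((n : ℝ) * R₂)) * ∑ y : Fin n → Y, C.weight m₁ m₂ y *
          (2 : ℝ) ^ ((n : ℝ) * C.info₂ y m) else 0 := by
  have h2 : ∀ a b : ℝ, (2 : ℝ) ^ ((n : ℝ) * (a - b)) =
      (2 : ℝ) ^ (-((n : ℝ) * b)) * (2 : ℝ) ^ ((n : ℝ) * a) := fun a b => by
    rw [← Real.rpow_add (by norm_num)]; congr 1; ring
  have hswap : ∀ {ι : Type} [Fintype ι] (p : ι → Prop) [DecidablePred p] (κ : ℝ)
      (g : ι → (Fin n → Y) → ℝ),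
      ∑ y : Fin n → Y, C.weight m₁ m₂ y * ∑ i, (if p i then κ * g i y else 0) =
        ∑ i, if p i then κ * ∑ y : Fin n → Y, C.weight m₁ m₂ y * g i y else 0 := by
    intro ι _ p _ κ g
    simp only [Finset.mul_sum]
    rw [Finset.sum_comm]
    refine Finset.sum_congr rfl fun i _ => ?_
    split_ifs
    · exact Finset.sum_congr rfl fun y _ => by ring
    · simp
  rw [← hswap, ← hswap, ← hswap, ← Finset.sum_add_distrib, ← Finset.sum_add_distrib,
    ← Finset.sum_add_distrib]
  refine Finset.sum_congr rfl fun y _ => ?_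
  simp only [Codebook.score, h2 _ (R₁ + R₂), h2 _ R₁, h2 _ R₂]
  ring

/-- The random superposition code has polynomially bounded expected score. -/
theorem sum_permBook_score_le (hn : 0 < n) (hR₁ : 0 ≤ R₁) (hR₂ : 0 ≤ R₂)
    (m₁ : Msg n R₁) (m₂ : Msg n R₂) :
    ∑ ω : (Msg n R₂ → Equiv.Perm (Fin n)) × (Msg n R₁ × Msg n R₂ → Stab u),
      ∑ y : Fin n → Y, (permBook u x ω.1 ω.2).weight m₁ m₂ y *
        (permBook u x ω.1 ω.2).score m₁ m₂ y ≤
      (polyFactor U X Y n + 8 * (polyFactor U X Y n * polyFactor U X Y n)) *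
        Fintype.card ((Msg n R₂ → Equiv.Perm (Fin n)) × (Msg n R₁ × Msg n R₂ → Stab u)) := by
  set B := polyFactor U X Y n
  have hB : 0 < B := polyFactor_pos n
  set N : ℝ := (Fintype.card ((Msg n R₂ → Equiv.Perm (Fin n)) ×
    (Msg n R₁ × Msg n R₂ → Stab u)) : ℝ) with hN
  have hN' : N = (Fintype.card (Msg n R₂ → Equiv.Perm (Fin n)) : ℝ) *
      Fintype.card (Msg n R₁ × Msg n R₂ → Stab u) := by rw [hN, Fintype.card_prod]; push_cast; rfl
  have hK : 0 ≤ B * B * N := by positivity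
  have hp : ∀ R : ℝ, (0 : ℝ) ≤ (2 : ℝ) ^ (-((n : ℝ) * R)) := fun R => by positivity
  simp only [weight_mul_score_eq, Finset.sum_add_distrib]
  have h0 : ∑ ω : (Msg n R₂ → Equiv.Perm (Fin n)) × (Msg n R₁ × Msg n R₂ → Stab u),
      ∑ y : Fin n → Y, (permBook u x ω.1 ω.2).weight m₁ m₂ y ≤ B * N := by
    refine (Finset.sum_le_sum fun ω _ => sum_weight_le_polyFactor _ _ _).trans (le_of_eq ?_)
    rw [Finset.sum_const, Finset.card_univ, nsmul_eq_mul, mul_comm]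
  have hA := sum_ite_const_mul_le (fun m : Msg n R₁ × Msg n R₂ => m.2 ≠ m₂)
    (fun m (ω : (Msg n R₂ → Equiv.Perm (Fin n)) × (Msg n R₁ × Msg n R₂ → Stab u)) =>
      ∑ y : Fin n → Y, (permBook u x ω.1 ω.2).weight m₁ m₂ y *
        (2 : ℝ) ^ ((n : ℝ) * (permBook u x ω.1 ω.2).info₁₂ y m)) _ (B * B * N)
    (hp (R₁ + R₂)) hK (fun m hm => by
      rw [Fintype.sum_prod_type_right]
      refine (Finset.sum_le_sum fun σ _ =>
        sum_perm_weight_mul_info₁₂_le u x hn σ m₁ m₂ m hm).trans (le_of_eq ?_)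
      rw [Finset.sum_const, Finset.card_univ, nsmul_eq_mul, hN']
      ring)
  have hC := sum_ite_const_mul_le (fun m : Msg n R₂ => m ≠ m₂)
    (fun m (ω : (Msg n R₂ → Equiv.Perm (Fin n)) × (Msg n R₁ × Msg n R₂ → Stab u)) =>
      ∑ y : Fin n → Y, (permBook u x ω.1 ω.2).weight m₁ m₂ y *
        (2 : ℝ) ^ ((n : ℝ) * (permBook u x ω.1 ω.2).info₂ y m)) _ (B * B * N)
    (hp R₂) hK (fun m hm => by
      rw [Fintype.sum_prod_type_right]
      refine (Finset.sum_le_sum fun σ _ =>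
        sum_perm_weight_mul_info₂_le u x hn σ m₁ m₂ m hm).trans (le_of_eq ?_)
      rw [Finset.sum_const, Finset.card_univ, nsmul_eq_mul, hN']
      ring)
  have hS := sum_ite_const_mul_le (fun m : Msg n R₁ => m ≠ m₁)
    (fun m (ω : (Msg n R₂ → Equiv.Perm (Fin n)) × (Msg n R₁ × Msg n R₂ → Stab u)) =>
      ∑ y : Fin n → Y, (permBook u x ω.1 ω.2).weight m₁ m₂ y *
        (2 : ℝ) ^ ((n : ℝ) * ((permBook u x ω.1 ω.2).info₁₂ y (m, m₂) -
          (permBook u x ω.1 ω.2).info₂ y m₂))) _ (B * B * N)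
    (hp R₁) hK (fun m hm => by
      rw [Fintype.sum_prod_type]
      refine (Finset.sum_le_sum fun π _ =>
        sum_stab_weight_mul_info_le u x hn π m₁ m m₂ hm).trans (le_of_eq ?_)
      rw [Finset.sum_const, Finset.card_univ, nsmul_eq_mul, hN']
      ring)
  -- Rounding up the message sets costs a factor 2 each, hence 4 for pairs; the constant 8 is `4 + 2
  -- + 2`.
  have c1 := card_msg_mul_le n hR₁
  have c2 := card_msg_mul_le n hR₂
  have c12 : (Fintype.card (Msg n R₁ × Msg n R₂) : ℝ) * (2 : ℝ) ^ (-((n : ℝ) * (R₁ + R₂))) ≤ 4 := by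
    have : (2 : ℝ) ^ (-((n : ℝ) * (R₁ + R₂))) =
        (2 : ℝ) ^ (-((n : ℝ) * R₁)) * (2 : ℝ) ^ (-((n : ℝ) * R₂)) := by
      rw [← Real.rpow_add (by norm_num)]; congr 1; ring
    rw [Fintype.card_prod, this]
    push_cast only [Nat.cast_mul]
    calc _ = ((Fintype.card (Msg n R₁) : ℝ) * (2 : ℝ) ^ (-((n : ℝ) * R₁))) *
          ((Fintype.card (Msg n R₂) : ℝ) * (2 : ℝ) ^ (-((n : ℝ) * R₂))) := by ring
      _ ≤ 2 * 2 := mul_le_mul c1 c2 (mul_nonneg (Nat.cast_nonneg _) (hp _)) (by norm_num)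
      _ = 4 := by norm_num
  have hA' := hA.trans (mul_le_mul_of_nonneg_right c12 hK)
  have hC' := hC.trans (mul_le_mul_of_nonneg_right c2 hK)
  have hS' := hS.trans (mul_le_mul_of_nonneg_right c1 hK)
  refine (add_le_add (add_le_add (add_le_add h0 hA') hS') hC').trans (le_of_eq ?_)
  ring

theorem exists_permBook_score_le (hn : 0 < n) (hR₁ : 0 ≤ R₁) (hR₂ : 0 ≤ R₂) :
    ∃ C : Codebook U X n R₁ R₂,
      (∀ m₁ m₂, seqType (pairSeq (C.u m₂) (C.x m₁ m₂)) = seqType (pairSeq u x)) ∧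
      Code.avg (fun m₁ m₂ => ∑ y : Fin n → Y, C.weight m₁ m₂ y * C.score m₁ m₂ y) ≤
        polyFactor U X Y n + 8 * (polyFactor U X Y n * polyFactor U X Y n) := by
  set B := polyFactor U X Y n + 8 * (polyFactor U X Y n * polyFactor U X Y n)
  let Ω := (Msg n R₂ → Equiv.Perm (Fin n)) × (Msg n R₁ × Msg n R₂ → Stab u)
  have hsum : ∑ ω : Ω, ∑ m₁, ∑ m₂, ∑ y : Fin n → Y, (permBook u x ω.1 ω.2).weight m₁ m₂ y *
        (permBook u x ω.1 ω.2).score m₁ m₂ y ≤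
      ∑ ω : Ω, (Fintype.card (Msg n R₁) * Fintype.card (Msg n R₂) : ℝ) * B := by
    rw [Finset.sum_comm]
    have h1 : ∀ m₁ : Msg n R₁, ∑ ω : Ω, ∑ m₂, ∑ y : Fin n → Y,
        (permBook u x ω.1 ω.2).weight m₁ m₂ y * (permBook u x ω.1 ω.2).score m₁ m₂ y ≤
        Fintype.card (Msg n R₂) * (B * Fintype.card Ω) := fun m₁ => by
      rw [Finset.sum_comm]
      refine (Finset.sum_le_sum fun m₂ _ =>
        sum_permBook_score_le u x hn hR₁ hR₂ m₁ m₂).trans (le_of_eq ?_)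
      rw [Finset.sum_const, Finset.card_univ, nsmul_eq_mul]
    refine (Finset.sum_le_sum fun m₁ _ => h1 m₁).trans (le_of_eq ?_)
    rw [Finset.sum_const, Finset.card_univ, nsmul_eq_mul, Finset.sum_const, Finset.card_univ,
      nsmul_eq_mul]
    ring
  obtain ⟨ω, -, hω⟩ := Finset.exists_le_of_sum_le Finset.univ_nonempty hsum
  refine ⟨permBook u x ω.1 ω.2, seqType_permBook u x ω.1 ω.2, ?_⟩
  have hpos : ∀ R, (0 : ℝ) < Fintype.card (Msg n R) := fun R => by
    rw [Fintype.card_fin]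
    exact_mod_cast Nat.ceil_pos.2 (by positivity)
  have := hpos R₁
  have := hpos R₂
  rw [Code.avg, div_le_iff₀ (by positivity), mul_comm B]
  exact hω

end RandomCode

/-! ### Approximating a distribution by types. -/

section TypeApproximation

variable {A : Type*} [Fintype A]

theorem exists_seq_cnt_eq {n : ℕ} (k : A → ℕ) (hk : ∑ a, k a = n) :
    ∃ s : Fin n → A, ∀ a, cnt s a = k a := by
  classical
  have hc : Fintype.card (Fin n) = Fintype.card (Σ a, Fin (k a)) := by simp [hk]
  let e := Fintype.equivOfCardEq hc
  refine ⟨fun i => (e i).1, fun a => ?_⟩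
  have h1 : cnt (fun i => (e i).1) a = Fintype.card {p : Σ a, Fin (k a) // p.1 = a} := by
    rw [Fintype.card_subtype]
    unfold cnt
    refine Finset.card_bij (fun i _ => e i) ?_ ?_ ?_
    · intro i hi; simpa using hi
    · intro i _ j _ h; exact e.injective h
    · intro j hj; exact ⟨e.symm j, by simpa using hj, by simp⟩
  rw [h1, Fintype.card_congr (Equiv.sigmaSubtype a), Fintype.card_fin]

/-- Every distribution is a limit of types. -/
theorem exists_seqType_tendsto (P : stdSimplex ℝ A) :
    ∃ s : ∀ n : ℕ, Fin n → A, Tendsto (fun n => seqType (s n)) atTop (𝓝 (P : A → ℝ)) := by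
  classical
  have hP0 : ∀ a, 0 ≤ (P : A → ℝ) a := P.2.1
  have hP1 : ∑ a, (P : A → ℝ) a = 1 := P.2.2
  obtain ⟨a₀⟩ : Nonempty A := by
    by_contra h
    rw [not_nonempty_iff] at h
    simp at hP1
  let f : ℕ → A → ℕ := fun n a => ⌊(P : A → ℝ) a * n⌋₊
  have hf : ∀ n, ∑ a ∈ Finset.univ.erase a₀, f n a ≤ n := by
    intro n
    have : ((∑ a ∈ Finset.univ.erase a₀, f n a : ℕ) : ℝ) ≤ n := by
      push_cast
      calc ∑ a ∈ Finset.univ.erase a₀, (f n a : ℝ)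
          ≤ ∑ a ∈ Finset.univ.erase a₀, (P : A → ℝ) a * n :=
            Finset.sum_le_sum fun a _ => Nat.floor_le (mul_nonneg (hP0 a) (by positivity))
        _ ≤ ∑ a, (P : A → ℝ) a * n :=
            Finset.sum_le_sum_of_subset_of_nonneg (Finset.erase_subset _ _)
              fun a _ _ => mul_nonneg (hP0 a) (by positivity)
        _ = n := by rw [← Finset.sum_mul, hP1, one_mul]
    exact_mod_cast this
  -- The letter `a₀` absorbs the rounding remainder, making the counts sum to exactly `n`; its limit
  -- then follows from normalization.
  let k : ℕ → A → ℕ := fun n => Function.update (f n) a₀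
    (n - ∑ a ∈ Finset.univ.erase a₀, f n a)
  have hke : ∀ n, ∀ a ∈ Finset.univ.erase a₀, k n a = f n a := fun n a ha =>
    Function.update_of_ne (Finset.ne_of_mem_erase ha) _ _
  have hk : ∀ n, ∑ a, k n a = n := by
    intro n
    rw [← Finset.add_sum_erase _ _ (Finset.mem_univ a₀), Finset.sum_congr rfl (hke n)]
    simp only [k, Function.update_self]
    exact Nat.sub_add_cancel (hf n)
  choose s hs using fun n => exists_seq_cnt_eq (k n) (hk n)
  refine ⟨s, ?_⟩
  have hlim : ∀ a, a ≠ a₀ → Tendsto (fun n => seqType (s n) a) atTop (𝓝 ((P : A → ℝ) a)) := by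
    intro a ha
    have := (tendsto_nat_floor_mul_div_atTop (hP0 a)).comp (tendsto_natCast_atTop_atTop (R := ℝ))
    refine this.congr fun n => ?_
    rw [seqType_apply, hs, hke n a (Finset.mem_erase.2 ⟨ha, Finset.mem_univ a⟩)]
    rfl
  rw [tendsto_pi_nhds]
  intro a
  by_cases ha : a = a₀
  · subst ha
    have h1 : Tendsto (fun n => 1 - ∑ b ∈ Finset.univ.erase a, seqType (s n) b) atTop
        (𝓝 (1 - ∑ b ∈ Finset.univ.erase a, (P : A → ℝ) b)) :=
      tendsto_const_nhds.sub (tendsto_finsetSum _ fun b hb => hlim b (Finset.ne_of_mem_erase hb))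
    have h2 : 1 - ∑ b ∈ Finset.univ.erase a, (P : A → ℝ) b = (P : A → ℝ) a := by
      rw [← hP1, ← Finset.add_sum_erase _ _ (Finset.mem_univ a)]; ring
    rw [h2] at h1
    refine h1.congr' ?_
    filter_upwards [eventually_gt_atTop 0] with n hn
    have h3 : ∑ b, seqType (s n) b = 1 := by
      have h4 : ∑ b, (cnt (s n) b : ℝ) = n := by exact_mod_cast sum_cnt (s n)
      simp only [seqType_apply, ← Finset.sum_div, h4]
      exact div_self (by positivity)
    rw [← h3, ← Finset.add_sum_erase _ _ (Finset.mem_univ a)]; ring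
  · exact hlim a ha

end TypeApproximation

/-! ### The log-sum inequality and nonnegativity of divergence. -/

section LogSum

variable {ι : Type*}

/-- The log-sum inequality. -/
theorem log_sum_inequality (s : Finset ι) (a b : ι → ℝ) (ha : ∀ i, 0 ≤ a i) (hb : ∀ i, 0 ≤ b i)
    (hab : ∀ i ∈ s, b i = 0 → a i = 0) :
    (∑ i ∈ s, a i) * Real.logb 2 ((∑ i ∈ s, a i) / ∑ i ∈ s, b i) ≤
      ∑ i ∈ s, a i * Real.logb 2 (a i / b i) := by
  set A := ∑ i ∈ s, a i with hA
  set B := ∑ i ∈ s, b i with hB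
  have hlog2 : 0 < Real.log 2 := Real.log_pos (by norm_num)
  suffices h : A * Real.log (A / B) ≤ ∑ i ∈ s, a i * Real.log (a i / b i) by
    simp only [Real.logb, ← mul_div_assoc, ← Finset.sum_div]
    gcongr
  rcases (Finset.sum_nonneg fun i _ => ha i : 0 ≤ A).eq_or_lt with h0 | hApos
  · rw [← hA] at h0
    have h1 : ∀ i ∈ s, a i = 0 := (Finset.sum_eq_zero_iff_of_nonneg fun i _ => ha i).1 h0.symm
    rw [← h0, zero_mul]
    exact Finset.sum_nonneg fun i hi => by rw [h1 i hi, zero_mul]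
  have hBpos : 0 < B := by
    refine lt_of_le_of_ne (Finset.sum_nonneg fun i _ => hb i) fun h => ?_
    have h1 := (Finset.sum_eq_zero_iff_of_nonneg fun i _ => hb i).1 h.symm
    exact hApos.ne' (Finset.sum_eq_zero fun i hi => hab i hi (h1 i hi))
  -- This is `log t ≥ 1 - 1/t` at `t = (a i / b i) / (A / B)`; the correction terms sum to zero.
  have key : ∀ i ∈ s, a i * Real.log (A / B) + (a i - b i * (A / B)) ≤
      a i * Real.log (a i / b i) := by
    intro i hi
    rcases (ha i).eq_or_lt with h | h
    · rw [← h]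
      have := mul_nonneg (hb i) (div_pos hApos hBpos).le
      simp; linarith
    · have hbi : 0 < b i := lt_of_le_of_ne (hb i) fun h' => h.ne' (hab i hi h'.symm)
      have h1 := Real.one_sub_inv_le_log_of_pos (x := a i / b i / (A / B)) (by positivity)
      rw [Real.log_div (by positivity) (by positivity)] at h1
      have h2 := mul_le_mul_of_nonneg_left h1 h.le
      have h3 : a i * (1 - (a i / b i / (A / B))⁻¹) = a i - b i * (A / B) := by
        field_simp
      rw [h3] at h2
      linarith
  have hsum := Finset.sum_le_sum key
  rw [Finset.sum_add_distrib, Finset.sum_sub_distrib, ← Finset.sum_mul, ← Finset.sum_mul, ← hA,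
    ← hB, mul_div_cancel₀ _ hBpos.ne', sub_self, add_zero] at hsum
  exact hsum

theorem kl_nonneg {β : Type*} [Fintype β] (V W : β → ℝ) (hV : V ∈ stdSimplex ℝ β)
    (hW : W ∈ stdSimplex ℝ β) (h : ∀ b, W b = 0 → V b = 0) :
    0 ≤ ∑ b, V b * Real.logb 2 (V b / W b) := by
  have := log_sum_inequality Finset.univ V W hV.1 hW.1 fun b _ => h b
  rwa [hV.2, hW.2, div_one, Real.logb_one, mul_zero] at this

end LogSum

/-! ### Continuity of mutual information. -/

section Continuity

variable {α β : Type*} [Fintype α] [Fintype β]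

/-- Mutual information in terms of entropies; it is continuous in the joint law. -/
def entropyInfo (Q : α × β → ℝ) : ℝ :=
  (∑ a, Real.negMulLog (fstMarg Q a) + ∑ b, Real.negMulLog (sndMarg Q b) -
    ∑ p, Real.negMulLog (Q p)) / Real.log 2

theorem continuous_entropyInfo : Continuous (entropyInfo : (α × β → ℝ) → ℝ) := by
  unfold entropyInfo fstMarg sndMarg
  have := Real.continuous_negMulLog
  fun_prop

theorem mutualInfo_eq_entropyInfo (Q : α × β → ℝ) (hQ : ∀ p, 0 ≤ Q p) :
    mutualInfo Q = entropyInfo Q := by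
  have hf : ∀ a b, Q (a, b) ≤ fstMarg Q a := fun a b =>
    Finset.single_le_sum (f := fun b => Q (a, b)) (fun _ _ => hQ _) (Finset.mem_univ b)
  have hs : ∀ a b, Q (a, b) ≤ sndMarg Q b := fun a b =>
    Finset.single_le_sum (f := fun a => Q (a, b)) (fun _ _ => hQ _) (Finset.mem_univ a)
  have h1 : ∀ a b, Q (a, b) * Real.log (Q (a, b) / (fstMarg Q a * sndMarg Q b)) =
      Q (a, b) * Real.log (Q (a, b)) - Q (a, b) * Real.log (fstMarg Q a) -
        Q (a, b) * Real.log (sndMarg Q b) := by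
    intro a b
    rcases (hQ (a, b)).eq_or_lt with h | h
    · rw [← h]; simp
    · have h2 := h.trans_le (hf a b)
      have h3 := h.trans_le (hs a b)
      rw [Real.log_div h.ne' (by positivity), Real.log_mul h2.ne' h3.ne']
      ring
  unfold mutualInfo entropyInfo
  simp only [Real.logb, ← mul_div_assoc, ← Finset.sum_div, h1]
  congr 1
  simp only [Finset.sum_sub_distrib, Real.negMulLog, neg_mul, Finset.sum_neg_distrib,
    ← Finset.sum_mul]
  rw [Fintype.sum_prod_type, Finset.sum_comm (f := fun a b => Q (a, b) * Real.log (sndMarg Q b))]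
  simp only [← Finset.sum_mul]
  change _ - ∑ a, fstMarg Q a * _ - ∑ b, sndMarg Q b * _ = _
  ring

end Continuity

/-! ### A common form of the exponents: semicontinuity and data processing. -/

section Exponents

variable {U X Y : Type*} [Fintype U] [Fintype X] [Fintype Y]

/-- The common form of the non-divergence parts of the exponents. -/
def penalty (l r₁ r₂ μ r c : ℝ) (P : U × X → ℝ) (V : U × X → Y → ℝ) : ℝ :=
  l * J₁₂ P V r₁ r₂ + μ * J₂ (jointUY P V) r + c

/-- `min_V [D(V ‖ W | P) + penalty]`. -/
def penExp (WY : X → Y → ℝ) (l r₁ r₂ μ r c : ℝ) (P : U × X → ℝ) : EReal :=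
  ⨅ V : U × X → stdSimplex ℝ Y,
    condKL (fun p => V p) (chanUX WY) P +
      ((penalty l r₁ r₂ μ r c P (fun p => V p) : ℝ) : EReal)

/-- A version of `penalty` that is continuous on the whole space. -/
def entropyPenalty (l r₁ r₂ μ r c : ℝ) (P : U × X → ℝ) (V : U × X → stdSimplex ℝ Y) : ℝ :=
  l * max (entropyInfo (joint P fun p => V p) - (r₁ + r₂)) 0 +
    μ * max (entropyInfo (jointUY P fun p => V p) - r) 0 + c

theorem penalty_eq_entropyPenalty (l r₁ r₂ μ r c : ℝ) (P : U × X → ℝ) (hP : ∀ p, 0 ≤ P p)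
    (V : U × X → stdSimplex ℝ Y) :
    penalty l r₁ r₂ μ r c P (fun p => V p) = entropyPenalty l r₁ r₂ μ r c P V := by
  have hV : ∀ p y, 0 ≤ (V p : Y → ℝ) y := fun p => (V p).2.1
  unfold penalty entropyPenalty J₁₂ J₂
  rw [mutualInfo_eq_entropyInfo, mutualInfo_eq_entropyInfo]
  · exact fun p => Finset.sum_nonneg fun x _ => mul_nonneg (hP _) (hV _ _)
  · exact fun p => mul_nonneg (hP _) (hV _ _)

theorem continuous_entropyPenalty (l r₁ r₂ μ r c : ℝ) :
    Continuous ↿(entropyPenalty l r₁ r₂ μ r c :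
      (U × X → ℝ) → (U × X → stdSimplex ℝ Y) → ℝ) := by
  have hV : ∀ p y, Continuous fun q : (U × X → ℝ) × (U × X → stdSimplex ℝ Y) =>
      (q.2 p : Y → ℝ) y := fun p y =>
    (continuous_apply y).comp (continuous_subtype_val.comp
      ((continuous_apply p).comp continuous_snd))
  have h1 : Continuous fun q : (U × X → ℝ) × (U × X → stdSimplex ℝ Y) =>
      joint q.1 (fun p => (q.2 p : Y → ℝ)) := by
    refine continuous_pi fun p => ?_
    exact ((continuous_apply p.1).comp continuous_fst).mul (hV _ _)
  have h2 : Continuous fun q : (U × X → ℝ) × (U × X → stdSimplex ℝ Y) =>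
      jointUY q.1 (fun p => (q.2 p : Y → ℝ)) := by
    refine continuous_pi fun p => ?_
    exact continuous_finsetSum _ fun x _ =>
      ((continuous_apply (p.1, x)).comp continuous_fst).mul (hV _ _)
  have h3 := continuous_entropyInfo.comp h1
  have h4 := continuous_entropyInfo.comp h2
  exact ((continuous_const.mul ((h3.sub continuous_const).max continuous_const)).add
    (continuous_const.mul ((h4.sub continuous_const).max continuous_const))).add continuous_const

/-- Lower semicontinuity of the exponents in the input law, in sequential form. -/
theorem eventually_le_penExp {WY : X → Y → ℝ} (hW : ∀ x, WY x ∈ stdSimplex ℝ Y)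
    (l r₁ r₂ μ r c : ℝ) {P : U × X → ℝ} (hP : ∀ p, 0 ≤ P p) {T : ℕ → U × X → ℝ}
    (hT : ∀ n p, 0 ≤ T n p) (hTP : Tendsto T atTop (𝓝 P)) {E : ℝ}
    (hE : (E : EReal) < penExp WY l r₁ r₂ μ r c P) :
    ∀ᶠ n in atTop, (E : EReal) ≤ penExp WY l r₁ r₂ μ r c (T n) := by
  obtain ⟨F, hEF, hF⟩ := EReal.lt_iff_exists_real_btwn.1 hE
  have hEF' : E < F := by exact_mod_cast hEF
  set G : (U × X → ℝ) → (U × X → stdSimplex ℝ Y) → ℝ := entropyPenalty l r₁ r₂ μ r c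
  have hcont : Continuous ↿G := continuous_entropyPenalty l r₁ r₂ μ r c
  obtain ⟨K, hK⟩ : ∃ K, ∀ V, |G P V| ≤ K := by
    obtain ⟨K, hK⟩ := isCompact_univ.exists_bound_of_continuousOn
      (f := G P) (hcont.comp (Continuous.prodMk_right P)).continuousOn
    exact ⟨K, fun V => hK V (Set.mem_univ V)⟩
  set η := F - E with hη
  have hηpos : 0 < η := by linarith
  -- Divergence may be infinite and is not uniformly continuous in `V`. Being nonnegative row by
  -- row, it needs only `T n ≥ (1 - ε) P`. The factor `1 - ε` costs at most `ε (|F| + |K|) ≤ η / 2`,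
  -- the other half of `η` paying for the change of the penalty.
  set ε := min (1 / 2) (η / (2 * (|F| + |K| + 1))) with hε
  have hden : 0 < 2 * (|F| + |K| + 1) := by positivity
  have hεpos : 0 < ε := lt_min (by norm_num) (by positivity)
  have hε1 : ε ≤ 1 / 2 := min_le_left _ _
  have hε2 : ε * (|F| + |K| + 1) ≤ η / 2 := by
    have : ε ≤ η / (2 * (|F| + |K| + 1)) := min_le_right _ _
    rw [le_div_iff₀ hden] at this
    linarith
  -- Uniformity in `V` comes from compactness of the space of stochastic matrices.
  have hunif : ∀ᶠ n in atTop, ∀ V, |G (T n) V - G P V| < η / 2 := by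
    have := Metric.tendstoUniformly_iff.1 (hcont.tendstoUniformly G P) (η / 2) (by positivity)
    filter_upwards [hTP.eventually this] with n hn V
    rw [← Real.dist_eq, dist_comm]
    exact hn V
  have hTle : ∀ᶠ n in atTop, ∀ p, (1 - ε) * P p ≤ T n p := by
    rw [eventually_all]
    intro p
    rcases (hP p).eq_or_lt with h | h
    · exact Eventually.of_forall fun n => by rw [← h, mul_zero]; exact hT n p
    · have h1 : (1 - ε) * P p < P p := by nlinarith
      exact ((tendsto_pi_nhds.1 hTP p).eventually (lt_mem_nhds h1)).mono fun n hn => hn.le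
  filter_upwards [hunif, hTle] with n hn1 hn2
  refine le_iInf fun V => ?_
  have hFV : (F : EReal) ≤ condKL (fun p => V p) (chanUX WY) P +
      ((penalty l r₁ r₂ μ r c P (fun p => V p) : ℝ) : EReal) := hF.le.trans (iInf_le _ V)
  rw [penalty_eq_entropyPenalty _ _ _ _ _ _ _ hP] at hFV
  rw [penalty_eq_entropyPenalty _ _ _ _ _ _ _ (hT n)]
  by_cases habs : ∀ a b, T n a ≠ 0 → chanUX WY a b = 0 → (V a : Y → ℝ) b = 0
  swap
  · rw [condKL, if_neg habs, EReal.top_add_coe]; exact le_top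
  have hsupp : ∀ a, P a ≠ 0 → T n a ≠ 0 := by
    intro a ha
    have h1 : 0 < P a := lt_of_le_of_ne (hP a) ha.symm
    have h2 : 0 < (1 - ε) * P a := mul_pos (by linarith) h1
    exact (h2.trans_le (hn2 a)).ne'
  have habs' : ∀ a b, P a ≠ 0 → chanUX WY a b = 0 → (V a : Y → ℝ) b = 0 :=
    fun a b ha => habs a b (hsupp a ha)
  rw [condKL, if_pos habs, ← EReal.coe_add, EReal.coe_le_coe_iff]
  rw [condKL, if_pos habs', ← EReal.coe_add, EReal.coe_le_coe_iff] at hFV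
  set d : U × X → ℝ := fun a => ∑ b, (V a : Y → ℝ) b *
    Real.logb 2 ((V a : Y → ℝ) b / chanUX WY a b)
  have hd : (1 - ε) * ∑ a, P a * d a ≤ ∑ a, T n a * d a := by
    rw [Finset.mul_sum]
    refine Finset.sum_le_sum fun a _ => ?_
    rw [← mul_assoc]
    by_cases ha : T n a = 0
    · have : P a = 0 := by by_contra h; exact hsupp a h ha
      rw [ha, this]; simp
    · exact mul_le_mul_of_nonneg_right (hn2 a)
        (kl_nonneg _ _ (V a).2 (hW a.2) fun b => habs a b ha)
  have h1 := abs_lt.1 (hn1 V)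
  have h2 := abs_le.1 (hK V)
  change F ≤ ∑ a, P a * d a + G P V at hFV
  change E ≤ ∑ a, T n a * d a + G (T n) V
  have h3 : (1 - ε) * F ≤ (1 - ε) * (∑ a, P a * d a + G P V) :=
    mul_le_mul_of_nonneg_left hFV (by linarith)
  have h4 : ε * F ≤ ε * |F| := mul_le_mul_of_nonneg_left (le_abs_self F) hεpos.le
  have h5 : ε * (-|K|) ≤ ε * G P V :=
    mul_le_mul_of_nonneg_left (by linarith [le_abs_self K]) hεpos.le
  nlinarith

/-- Data processing: averaging out the satellite codeword cannot increase the exponent. -/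
theorem Er₂_le_penExp (WY : X → Y → ℝ) (hW : ∀ x y, 0 ≤ WY x y) (l R₂ : ℝ) (P : U × X → ℝ)
    (hP : ∀ p, 0 ≤ P p) [Nonempty X] :
    Er₂ P WY l R₂ ≤ penExp WY 0 0 0 l R₂ 0 P := by
  classical
  refine le_iInf fun V => ?_
  have hV0 : ∀ p y, 0 ≤ (V p : Y → ℝ) y := fun p => (V p).2.1
  have hV1 : ∀ p, ∑ y, (V p : Y → ℝ) y = 1 := fun p => (V p).2.2
  by_cases habs : ∀ a b, P a ≠ 0 → chanUX WY a b = 0 → (V a : Y → ℝ) b = 0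
  swap
  · rw [condKL, if_neg habs, EReal.top_add_coe]; exact le_top
  have hmem : ∀ u, fstMarg P u ≠ 0 →
      (fun y => (∑ x, P (u, x) * (V (u, x) : Y → ℝ) y) / fstMarg P u) ∈ stdSimplex ℝ Y := by
    intro u hu
    refine ⟨fun y => div_nonneg (Finset.sum_nonneg fun x _ => mul_nonneg (hP _) (hV0 _ _))
      (Finset.sum_nonneg fun x _ => hP _), ?_⟩
    rw [← Finset.sum_div, Finset.sum_comm]
    simp only [← Finset.mul_sum, hV1, mul_one]
    exact div_self hu
  let x₀ : X := Classical.arbitrary X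
  -- The average of `V` over `x` given `u`, with an arbitrary row where `u` has probability zero.
  let V' : U → stdSimplex ℝ Y := fun u =>
    if h : fstMarg P u ≠ 0 then ⟨_, hmem u h⟩ else V (u, x₀)
  have hV' : ∀ u y, fstMarg P u ≠ 0 →
      (V' u : Y → ℝ) y = (∑ x, P (u, x) * (V (u, x) : Y → ℝ) y) / fstMarg P u := by
    intro u y h
    simp only [V', dif_pos h]
    rfl
  have hzero : ∀ u, fstMarg P u = 0 → ∀ x, P (u, x) = 0 := fun u h x =>
    (Finset.sum_eq_zero_iff_of_nonneg fun x _ => hP (u, x)).1 h x (Finset.mem_univ x)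
  have hmul : ∀ u y, fstMarg P u * (V' u : Y → ℝ) y =
      ∑ x, P (u, x) * (V (u, x) : Y → ℝ) y := by
    intro u y
    by_cases h : fstMarg P u = 0
    · rw [h, zero_mul, Finset.sum_eq_zero]
      intro x _
      rw [hzero u h, zero_mul]
    · rw [hV' u y h, mul_div_cancel₀ _ h]
  have hchan : ∀ u y, fstMarg P u * chanU P WY u y = ∑ x, P (u, x) * WY x y := by
    intro u y
    unfold chanU
    rw [Finset.mul_sum]
    refine Finset.sum_congr rfl fun x _ => ?_
    by_cases h : fstMarg P u = 0
    · rw [h, hzero u h]; simp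
    · field_simp
  have hjoint : joint (fstMarg P) (fun u => (V' u : Y → ℝ)) =
      jointUY P fun p => (V p : Y → ℝ) := by
    funext p
    exact hmul p.1 p.2
  refine (iInf_le _ V').trans ?_
  have habs' : ∀ a b, fstMarg P a ≠ 0 → chanU P WY a b = 0 → (V' a : Y → ℝ) b = 0 := by
    intro u y hu hc
    have h1 := hchan u y
    rw [hc, mul_zero] at h1
    have h2 := (Finset.sum_eq_zero_iff_of_nonneg fun x _ => mul_nonneg (hP (u, x)) (hW x y)).1
      h1.symm
    rw [hV' u y hu, Finset.sum_eq_zero, zero_div]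
    intro x hx
    by_cases hp : P (u, x) = 0
    · rw [hp, zero_mul]
    · have h3 : WY x y = 0 := (mul_eq_zero.1 (h2 x hx)).resolve_left hp
      rw [habs (u, x) y hp h3, mul_zero]
  rw [condKL, if_pos habs', condKL, if_pos habs, ← EReal.coe_add, ← EReal.coe_add,
    EReal.coe_le_coe_iff, hjoint]
  have hpen : penalty 0 0 0 l R₂ 0 P (fun p => (V p : Y → ℝ)) =
      l * J₂ (jointUY P fun p => (V p : Y → ℝ)) R₂ := by
    unfold penalty; ring
  rw [hpen]
  refine add_le_add_left ?_ _
  rw [Fintype.sum_prod_type]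
  refine Finset.sum_le_sum fun u _ => ?_
  simp only [Finset.mul_sum]
  rw [Finset.sum_comm]
  refine Finset.sum_le_sum fun y _ => ?_
  -- Merging the terms over `x` for fixed `(u, y)` cannot increase divergence, while the law of `(U,
  -- Y)`, hence the penalty, is unchanged.
  have hls := log_sum_inequality Finset.univ (fun x => P (u, x) * (V (u, x) : Y → ℝ) y)
    (fun x => P (u, x) * WY x y) (fun x => mul_nonneg (hP _) (hV0 _ _))
    (fun x => mul_nonneg (hP _) (hW _ _)) (fun x _ h => by
      rcases mul_eq_zero.1 h with h | h
      · rw [h, zero_mul]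
      · by_cases hp : P (u, x) = 0
        · rw [hp, zero_mul]
        · rw [habs (u, x) y hp h, mul_zero])
  rw [← hmul, ← hchan] at hls
  have hr : ∀ x, P (u, x) * (V (u, x) : Y → ℝ) y *
      Real.logb 2 (P (u, x) * (V (u, x) : Y → ℝ) y / (P (u, x) * WY x y)) =
      P (u, x) * ((V (u, x) : Y → ℝ) y *
        Real.logb 2 ((V (u, x) : Y → ℝ) y / chanUX WY (u, x) y)) := by
    intro x
    by_cases hp : P (u, x) = 0
    · rw [hp]; simp
    · rw [mul_div_mul_left _ _ hp, mul_assoc]; rfl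
  rw [Finset.sum_congr rfl fun x _ => hr x] at hls
  refine le_trans (le_of_eq ?_) hls
  by_cases hu : fstMarg P u = 0
  · rw [hu]; simp
  · rw [mul_div_mul_left _ _ hu, mul_assoc]

end Exponents

/-! ### Passing to exponents. -/

section Liminf

/-- A subexponential prefactor is absorbed by the gap between two reals `x < z` below `E`. -/
theorem expo_liminf_ge {E : EReal} {p B : ℕ → ℝ} (hp : ∀ n, 0 ≤ p n)
    (hB : ∀ δ : ℝ, 0 < δ → ∀ᶠ n : ℕ in atTop, B n ≤ (2 : ℝ) ^ ((n : ℝ) * δ))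
    (h : ∀ E' : ℝ, (E' : EReal) < E →
      ∀ᶠ n : ℕ in atTop, p n ≤ B n * (2 : ℝ) ^ (-((n : ℝ) * E'))) :
    E ≤ liminf (fun n => expo n (p n)) atTop := by
  refine le_of_forall_lt fun a ha => ?_
  obtain ⟨x, hax, hxE⟩ := EReal.lt_iff_exists_real_btwn.1 ha
  obtain ⟨z, hxz, hzE⟩ := EReal.lt_iff_exists_real_btwn.1 hxE
  have hxz' : x < z := by exact_mod_cast hxz
  refine hax.trans_le (le_liminf_of_le (by isBoundedDefault) ?_)
  filter_upwards [h z hzE, hB (z - x) (by linarith), eventually_gt_atTop 0] with n h1 h2 hn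
  unfold expo
  split_ifs with h0
  · exact le_top
  have hpos : 0 < p n := lt_of_le_of_ne (hp n) (Ne.symm h0)
  have hn' : (0 : ℝ) < n := by exact_mod_cast hn
  rw [EReal.coe_le_coe_iff]
  have h3 : p n ≤ (2 : ℝ) ^ (-((n : ℝ) * x)) := by
    refine h1.trans ((mul_le_mul_of_nonneg_right h2 (by positivity)).trans (le_of_eq ?_))
    rw [← Real.rpow_add (by norm_num)]
    congr 1; ring
  have h4 : Real.logb 2 (p n) ≤ -((n : ℝ) * x) := by
    rw [Real.logb_le_iff_le_rpow (by norm_num) hpos]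
    exact h3
  rw [one_div (p n), Real.logb_inv, div_mul_eq_mul_div, one_mul, le_div_iff₀ hn']
  linarith

theorem eventually_polyFactor_le (U X Y : Type*) [Fintype U] [Fintype X] [Fintype Y] (δ : ℝ)
    (hδ : 0 < δ) :
    ∀ᶠ n : ℕ in atTop, 2 * (polyFactor U X Y n +
      8 * (polyFactor U X Y n * polyFactor U X Y n)) ≤ (2 : ℝ) ^ ((n : ℝ) * δ) := by
  set d := polyDeg U X Y with hd
  have hr : 1 < (2 : ℝ) ^ δ := Real.one_lt_rpow (by norm_num) hδ
  have hlim := tendsto_pow_const_div_const_pow_of_one_lt (2 * d) hr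
  -- For `n ≥ 1`, `3 (n + 1) ≤ 6 n`; and as the polynomial factor `F` is at least 1, `2 (F + 8 F²) ≤
  -- 18 F²`.
  set c : ℝ := 18 * 6 ^ (2 * d) with hc
  have hcpos : 0 < c := by positivity
  filter_upwards [hlim.eventually (gt_mem_nhds (show (0 : ℝ) < 1 / c by positivity)),
    eventually_ge_atTop 1] with n h1 hn
  have hn' : (1 : ℝ) ≤ n := by exact_mod_cast hn
  have hF1 : 1 ≤ polyFactor U X Y n := one_le_pow₀ (by linarith)
  have hF2 : polyFactor U X Y n ≤ (6 * (n : ℝ)) ^ d :=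
    pow_le_pow_left₀ (by positivity) (by linarith) d
  have hF3 : polyFactor U X Y n * polyFactor U X Y n ≤ 6 ^ (2 * d) * (n : ℝ) ^ (2 * d) := by
    calc _ ≤ (6 * (n : ℝ)) ^ d * (6 * (n : ℝ)) ^ d :=
          mul_le_mul hF2 hF2 (by linarith) (by positivity)
      _ = _ := by rw [← pow_add, ← two_mul, mul_pow]
  rw [div_lt_div_iff₀ (by positivity) hcpos, one_mul] at h1
  have h2 : (2 : ℝ) ^ ((n : ℝ) * δ) = ((2 : ℝ) ^ δ) ^ n := by
    rw [mul_comm, Real.rpow_mul (by norm_num), Real.rpow_natCast]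
  rw [h2]
  nlinarith

end Liminf

/-! ### Joint types with the output; elementary bounds on block probabilities. -/

section Probability

variable {U X Y : Type*} {n : ℕ}

theorem jointUY_seqType [Fintype X] {u : Fin n → U} {x : Fin n → X} {y : Fin n → Y}
    {V : U × X → Y → ℝ}
    (hV : ∀ a b, seqType (pairSeq u x) a * V a b = seqType (pairSeq (pairSeq u x) y) (a, b)) :
    jointUY (seqType (pairSeq u x)) V = seqType (pairSeq u y) := by
  funext p
  obtain ⟨a, b⟩ := p
  simp only [jointUY, hV]
  rw [← fstMarg_seqType (pairSeq u y) x, fstMarg]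
  refine Finset.sum_congr rfl fun c _ => ?_
  rw [seqType_apply, seqType_apply, cnt_pairSeq_right_comm]

variable [Fintype Y]

theorem blockProb_nonneg {WY : X → Y → ℝ} (hW : ∀ x y, 0 ≤ WY x y) (x : Fin n → X)
    (D : Set (Fin n → Y)) : 0 ≤ blockProb WY x D :=
  Finset.sum_nonneg fun _ _ => Set.indicator_nonneg
    (fun _ _ => Finset.prod_nonneg fun _ _ => hW _ _) _

theorem blockProb_mono {WY : X → Y → ℝ} (hW : ∀ x y, 0 ≤ WY x y) (x : Fin n → X)
    {D D' : Set (Fin n → Y)} (h : D ⊆ D') : blockProb WY x D ≤ blockProb WY x D' :=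
  Finset.sum_le_sum fun y _ => Set.indicator_le_indicator_of_subset h
    (fun _ => Finset.prod_nonneg fun _ _ => hW _ _) y

theorem blockProb_union_le {WY : X → Y → ℝ} (hW : ∀ x y, 0 ≤ WY x y) (x : Fin n → X)
    (D D' : Set (Fin n → Y)) :
    blockProb WY x (D ∪ D') ≤ blockProb WY x D + blockProb WY x D' := by
  unfold blockProb
  rw [← Finset.sum_add_distrib]
  refine Finset.sum_le_sum fun y _ => ?_
  have h0 : 0 ≤ ∏ i, WY (x i) (y i) := Finset.prod_nonneg fun _ _ => hW _ _
  classical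
  simp only [Set.indicator_apply, Set.mem_union]
  split_ifs <;> simp_all

end Probability

/-! ### Error events of the two-step decoder and their probabilities. -/

section Decoder

variable {U X Y : Type*} [Fintype U] [Fintype Y] {n : ℕ} {R₁ R₂ : ℝ}

namespace Codebook

/-- Some other cloud center prevents the sent one from passing the second test with strict
inequality. -/
def rivalCloud (C : Codebook U X n R₁ R₂) (S₂ l₂ : ℝ) (m₂ : Msg n R₂) : Set (Fin n → Y) :=
  {y | ∃ m ≠ m₂, C.info₂ y m₂ ≤ S₂ + l₂ * max (C.info₂ y m - R₂) 0}

/-- A wrong cloud center beats the sent one in the second test. -/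
def wrongCloud (C : Codebook U X n R₁ R₂) (S₂ l₂ : ℝ) (m₂ : Msg n R₂) : Set (Fin n → Y) :=
  {y | ∃ m ≠ m₂, S₂ + l₂ * max (C.info₂ y m₂ - R₂) 0 ≤ C.info₂ y m}

/-- If `i` strictly passes a test against `j`, then `j` fails it against `i`. -/
theorem not_beat_of_strict {i j S R l : ℝ} (hS : R ≤ S) (hl : 1 ≤ l)
    (h : S + l * max (j - R) 0 < i) : ¬ S + l * max (i - R) 0 ≤ j := by
  -- As `S ≥ R` and `l ≥ 1`, the threshold `S + l * |t - R|⁺` is at least `t`; the two tests would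
  -- give both `j < i` and `i ≤ j`.
  intro h'
  have h1 : max (i - R) 0 ≤ l * max (i - R) 0 := le_mul_of_one_le_left (le_max_right _ _) hl
  have h2 : max (j - R) 0 ≤ l * max (j - R) 0 := le_mul_of_one_le_left (le_max_right _ _) hl
  have h3 := le_max_left (i - R) 0
  have h4 := le_max_left (j - R) 0
  linarith

theorem existsUnique_step₂ {C : Codebook U X n R₁ R₂} {S₂ l₂ : ℝ} {m₂ : Msg n R₂} {y : Fin n → Y}
    (hS₂ : R₂ ≤ S₂) (hl : 1 ≤ l₂)
    (hy : y ∉ C.rivalCloud S₂ l₂ m₂) :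
    C.Step₂ S₂ l₂ y m₂ ∧ ∀ m, C.Step₂ S₂ l₂ y m → m = m₂ := by
  have h : ∀ m ≠ m₂, S₂ + l₂ * max (C.info₂ y m - R₂) 0 < C.info₂ y m₂ := by
    intro m hm
    by_contra hc
    exact hy ⟨m, hm, not_lt.1 hc⟩
  refine ⟨fun m hm => (h m hm).le, fun m hm => ?_⟩
  by_contra hne
  exact not_beat_of_strict hS₂ hl (h m hne) (hm _ (Ne.symm hne))

variable [Fintype X]

variable (C : Codebook U X n R₁ R₂) (S₁ S₂ l₁₂ : ℝ) (m₁ : Msg n R₁) (m₂ : Msg n R₂)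

/-- Some other pair prevents the sent pair from passing the first test with strict inequality. -/
def rivalPair : Set (Fin n → Y) :=
  {y | ∃ m ≠ (m₁, m₂), C.info₁₂ y (m₁, m₂) ≤ (S₁ + S₂) + l₁₂ * max (C.info₁₂ y m - (R₁ + R₂)) 0}

/-- A pair with wrong first message beats the sent pair in the first test. -/
def wrongPair₁ : Set (Fin n → Y) :=
  {y | ∃ m : Msg n R₁ × Msg n R₂, m.1 ≠ m₁ ∧
    (S₁ + S₂) + l₁₂ * max (C.info₁₂ y (m₁, m₂) - (R₁ + R₂)) 0 ≤ C.info₁₂ y m}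

/-- A pair with wrong second message beats the sent pair in the first test. -/
def wrongPair₂ : Set (Fin n → Y) :=
  {y | ∃ m : Msg n R₁ × Msg n R₂, m.2 ≠ m₂ ∧
    (S₁ + S₂) + l₁₂ * max (C.info₁₂ y (m₁, m₂) - (R₁ + R₂)) 0 ≤ C.info₁₂ y m}

variable {C S₁ S₂ l₁₂ m₁ m₂} {l₂ : ℝ} {y : Fin n → Y}

theorem existsUnique_step₁ (hS₁ : R₁ ≤ S₁) (hS₂ : R₂ ≤ S₂) (hl : 1 ≤ l₁₂)
    (hy : y ∉ C.rivalPair S₁ S₂ l₁₂ m₁ m₂) :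
    C.Step₁ S₁ S₂ l₁₂ y (m₁, m₂) ∧ ∀ m, C.Step₁ S₁ S₂ l₁₂ y m → m = (m₁, m₂) := by
  have h : ∀ m ≠ (m₁, m₂),
      (S₁ + S₂) + l₁₂ * max (C.info₁₂ y m - (R₁ + R₂)) 0 < C.info₁₂ y (m₁, m₂) := by
    intro m hm
    by_contra hc
    exact hy ⟨m, hm, not_lt.1 hc⟩
  refine ⟨fun m hm => (h m hm).le, fun m hm => ?_⟩
  by_contra hne
  exact not_beat_of_strict (by linarith) hl (h m hne) (hm _ (Ne.symm hne))

theorem mem_rivalPair_of_not_existsUnique (hS₁ : R₁ ≤ S₁) (hS₂ : R₂ ≤ S₂) (hl : 1 ≤ l₁₂)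
    (h : ¬ ∃! m, C.Step₁ S₁ S₂ l₁₂ y m) : y ∈ C.rivalPair S₁ S₂ l₁₂ m₁ m₂ := by
  by_contra hy
  exact h ⟨(m₁, m₂), existsUnique_step₁ hS₁ hS₂ hl hy⟩

theorem mem_rivalPair_of_fst_ne (hS₁ : R₁ ≤ S₁) (hS₂ : R₂ ≤ S₂) (hl : 1 ≤ l₁₂)
    (h : (C.twoStep S₁ S₂ l₁₂ l₂ y).1 ≠ some m₁) : y ∈ C.rivalPair S₁ S₂ l₁₂ m₁ m₂ := by
  by_contra hy
  obtain ⟨h1, h2⟩ := existsUnique_step₁ hS₁ hS₂ hl hy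
  have hu : ∃! m, C.Step₁ S₁ S₂ l₁₂ y m := ⟨_, h1, h2⟩
  refine h ?_
  rw [twoStep, dif_pos hu, h2 _ hu.exists.choose_spec]

theorem mem_wrongPair₁_of_fst_eq {m : Msg n R₁} (hm : m ≠ m₁)
    (h : (C.twoStep S₁ S₂ l₁₂ l₂ y).1 = some m) : y ∈ C.wrongPair₁ S₁ S₂ l₁₂ m₁ m₂ := by
  unfold twoStep at h
  split_ifs at h with h1 h2
  · have hs := h1.exists.choose_spec
    have he : h1.exists.choose.1 = m := Option.some.inj h
    have hne : h1.exists.choose.1 ≠ m₁ := he ▸ hm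
    exact ⟨_, hne, hs (m₁, m₂) fun hh => hne (congrArg Prod.fst hh).symm⟩

/-- If Step 1 decides, the pair it chose has a wrong second message. If not, the sent pair has a
rival, and Step 2 can fail only if the sent cloud has one too. -/
theorem mem_of_snd_ne (hS₁ : R₁ ≤ S₁) (hS₂ : R₂ ≤ S₂) (hl : 1 ≤ l₁₂) (hl₂ : 1 ≤ l₂)
    (h : (C.twoStep S₁ S₂ l₁₂ l₂ y).2 ≠ some m₂) :
    y ∈ C.wrongPair₂ S₁ S₂ l₁₂ m₁ m₂ ∪
      (C.rivalPair S₁ S₂ l₁₂ m₁ m₂ ∩ C.rivalCloud S₂ l₂ m₂) := by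
  by_cases h1 : ∃! m, C.Step₁ S₁ S₂ l₁₂ y m
  · left
    rw [twoStep, dif_pos h1] at h
    have hne : h1.exists.choose.2 ≠ m₂ := fun hh => h (congrArg some hh)
    exact ⟨_, hne, h1.exists.choose_spec (m₁, m₂) fun hh => hne (congrArg Prod.snd hh).symm⟩
  · refine Or.inr ⟨mem_rivalPair_of_not_existsUnique hS₁ hS₂ hl h1, ?_⟩
    by_contra hy
    obtain ⟨h2, h3⟩ := existsUnique_step₂ hS₂ hl₂ hy
    have hu : ∃! m, C.Step₂ S₂ l₂ y m := ⟨_, h2, h3⟩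
    refine h ?_
    rw [twoStep, dif_neg h1, dif_pos hu, h3 _ hu.exists.choose_spec]

theorem mem_of_snd_eq (hS₁ : R₁ ≤ S₁) (hS₂ : R₂ ≤ S₂) (hl : 1 ≤ l₁₂) {m : Msg n R₂}
    (hm : m ≠ m₂) (h : (C.twoStep S₁ S₂ l₁₂ l₂ y).2 = some m) :
    y ∈ C.wrongPair₂ S₁ S₂ l₁₂ m₁ m₂ ∪
      (C.rivalPair S₁ S₂ l₁₂ m₁ m₂ ∩ C.wrongCloud S₂ l₂ m₂) := by
  unfold twoStep at h
  split_ifs at h with h1 h2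
  · left
    have he : h1.exists.choose.2 = m := Option.some.inj h
    have hne : h1.exists.choose.2 ≠ m₂ := he ▸ hm
    exact ⟨_, hne, h1.exists.choose_spec (m₁, m₂) fun hh => hne (congrArg Prod.snd hh).symm⟩
  · refine Or.inr ⟨mem_rivalPair_of_not_existsUnique hS₁ hS₂ hl h1, ?_⟩
    have he : h2.exists.choose = m := Option.some.inj h
    have hne : h2.exists.choose ≠ m₂ := he ▸ hm
    exact ⟨_, hne, h2.exists.choose_spec m₂ hne.symm⟩

/-! ### Error events force a large score -/

/-- The value of `penalty` at the joint type of the sent codewords and the channel output. -/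
def outputPenalty (C : Codebook U X n R₁ R₂) (l r₁ r₂ μ r c : ℝ) (m₁ : Msg n R₁)
    (m₂ : Msg n R₂) (y : Fin n → Y) : ℝ :=
  l * max (C.info₁₂ y (m₁, m₂) - (r₁ + r₂)) 0 + μ * max (C.info₂ y m₂ - r) 0 + c

/-- The summand 1 in `score` exists to cover the clipping of exponents at zero. -/
theorem two_rpow_max_le (a : ℝ) : (2 : ℝ) ^ ((n : ℝ) * max a 0) ≤ 1 + (2 : ℝ) ^ ((n : ℝ) * a) := by
  have : (0 : ℝ) ≤ (2 : ℝ) ^ ((n : ℝ) * a) := by positivity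
  rcases le_total a 0 with h | h
  · rw [max_eq_right h, mul_zero, Real.rpow_zero]; linarith
  · rw [max_eq_left h]; linarith

theorem two_rpow_le_of_le {g a s : ℝ} (hs : 1 + (2 : ℝ) ^ ((n : ℝ) * a) ≤ s)
    (h : g ≤ max a 0) : (2 : ℝ) ^ ((n : ℝ) * g) ≤ s := by
  refine le_trans ?_ ((two_rpow_max_le a).trans hs)
  exact Real.rpow_le_rpow_of_exponent_le (by norm_num)
    (mul_le_mul_of_nonneg_left h (Nat.cast_nonneg n))

theorem sum_ite_two_rpow_nonneg {ι : Type*} [Fintype ι] (p : ι → Prop) [DecidablePred p]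
    (g : ι → ℝ) : 0 ≤ ∑ i, if p i then (2 : ℝ) ^ (g i) else 0 :=
  Finset.sum_nonneg fun i _ => by split_ifs <;> positivity

theorem two_rpow_le_sum_ite {ι : Type*} [Fintype ι] (p : ι → Prop) [DecidablePred p]
    (g : ι → ℝ) (i : ι) (hi : p i) : (2 : ℝ) ^ (g i) ≤ ∑ i, if p i then (2 : ℝ) ^ (g i) else 0 := by
  have := Finset.single_le_sum (f := fun i => if p i then (2 : ℝ) ^ (g i) else 0)
    (fun i _ => by split_ifs <;> positivity) (Finset.mem_univ i)
  simpa [hi] using this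

theorem score_ge_pair {m : Msg n R₁ × Msg n R₂} (hm : m.2 ≠ m₂) :
    1 + (2 : ℝ) ^ ((n : ℝ) * (C.info₁₂ y m - (R₁ + R₂))) ≤ C.score m₁ m₂ y := by
  have h1 := two_rpow_le_sum_ite (fun m : Msg n R₁ × Msg n R₂ => m.2 ≠ m₂)
    (fun m => (n : ℝ) * (C.info₁₂ y m - (R₁ + R₂))) m hm
  have h2 := sum_ite_two_rpow_nonneg (fun m : Msg n R₁ => m ≠ m₁)
    (fun m => (n : ℝ) * (C.info₁₂ y (m, m₂) - C.info₂ y m₂ - R₁))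
  have h3 := sum_ite_two_rpow_nonneg (fun m : Msg n R₂ => m ≠ m₂)
    (fun m => (n : ℝ) * (C.info₂ y m - R₂))
  unfold score
  linarith

theorem score_ge_satellite {m : Msg n R₁} (hm : m ≠ m₁) :
    1 + (2 : ℝ) ^ ((n : ℝ) * (C.info₁₂ y (m, m₂) - C.info₂ y m₂ - R₁)) ≤ C.score m₁ m₂ y := by
  have h1 := sum_ite_two_rpow_nonneg (fun m : Msg n R₁ × Msg n R₂ => m.2 ≠ m₂)
    (fun m => (n : ℝ) * (C.info₁₂ y m - (R₁ + R₂)))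
  have h2 := two_rpow_le_sum_ite (fun m : Msg n R₁ => m ≠ m₁)
    (fun m => (n : ℝ) * (C.info₁₂ y (m, m₂) - C.info₂ y m₂ - R₁)) m hm
  have h3 := sum_ite_two_rpow_nonneg (fun m : Msg n R₂ => m ≠ m₂)
    (fun m => (n : ℝ) * (C.info₂ y m - R₂))
  unfold score
  linarith

theorem score_ge_cloud {m : Msg n R₂} (hm : m ≠ m₂) :
    1 + (2 : ℝ) ^ ((n : ℝ) * (C.info₂ y m - R₂)) ≤ C.score m₁ m₂ y := by
  have h1 := sum_ite_two_rpow_nonneg (fun m : Msg n R₁ × Msg n R₂ => m.2 ≠ m₂)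
    (fun m => (n : ℝ) * (C.info₁₂ y m - (R₁ + R₂)))
  have h2 := sum_ite_two_rpow_nonneg (fun m : Msg n R₁ => m ≠ m₁)
    (fun m => (n : ℝ) * (C.info₁₂ y (m, m₂) - C.info₂ y m₂ - R₁))
  have h3 := two_rpow_le_sum_ite (fun m : Msg n R₂ => m ≠ m₂)
    (fun m => (n : ℝ) * (C.info₂ y m - R₂)) m hm
  unfold score
  linarith

/-- Inverting a test inequality. -/
theorem inv_mul_max_le {i j S R l : ℝ} (hl : 1 ≤ l) (h : i ≤ S + l * max (j - R) 0) :
    1 / l * max (i - S) 0 ≤ max (j - R) 0 := by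
  have hl' : 0 < l := by linarith
  rw [one_div, inv_mul_le_iff₀ hl']
  exact max_le (by linarith) (mul_nonneg hl'.le (le_max_right _ _))

/-- For a rival in the sent cloud, `Î₁₂ - R₁₂` exceeds the scored quantity `Î₁₂ - Î₂ - R₁` by `Î₂ -
R₂`; the coefficient `-1` pays for this. For another cloud the penalty is merely given away. -/
theorem score_ge_of_rivalPair (hl : 1 ≤ l₁₂) (hy : y ∈ C.rivalPair S₁ S₂ l₁₂ m₁ m₂) :
    (2 : ℝ) ^ ((n : ℝ) * C.outputPenalty (1 / l₁₂) S₁ S₂ (-1) R₂ 0 m₁ m₂ y) ≤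
      C.score m₁ m₂ y := by
  obtain ⟨⟨m, m'⟩, hm, h⟩ := hy
  have h1 := inv_mul_max_le hl h
  have h2 := le_max_right (C.info₂ y m₂ - R₂) 0
  have h3 := le_max_left (C.info₂ y m₂ - R₂) 0
  by_cases hm' : m' = m₂
  · subst hm'
    have hne : m ≠ m₁ := fun hh => hm (by rw [hh])
    refine two_rpow_le_of_le (score_ge_satellite hne) ?_
    unfold outputPenalty
    rcases le_total (C.info₁₂ y (m, m') - (R₁ + R₂)) 0 with h4 | h4
    · rw [max_eq_right h4] at h1
      have := le_max_right (C.info₁₂ y (m, m') - C.info₂ y m' - R₁) 0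
      linarith
    · rw [max_eq_left h4] at h1
      have := le_max_left (C.info₁₂ y (m, m') - C.info₂ y m' - R₁) 0
      linarith
  · refine two_rpow_le_of_le (score_ge_pair (m := (m, m')) hm') ?_
    unfold outputPenalty
    linarith

theorem score_ge_of_wrongPair₁ (hy : y ∈ C.wrongPair₁ S₁ S₂ l₁₂ m₁ m₂) :
    (2 : ℝ) ^ ((n : ℝ) * C.outputPenalty l₁₂ R₁ R₂ (-1) R₂ ((S₁ + S₂) - (R₁ + R₂)) m₁ m₂ y) ≤
      C.score m₁ m₂ y := by
  obtain ⟨⟨m, m'⟩, hm, h⟩ := hy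
  have h2 := le_max_right (C.info₂ y m₂ - R₂) 0
  have h3 := le_max_left (C.info₂ y m₂ - R₂) 0
  by_cases hm' : m' = m₂
  · subst hm'
    refine two_rpow_le_of_le (score_ge_satellite hm) ?_
    have := le_max_left (C.info₁₂ y (m, m') - C.info₂ y m' - R₁) 0
    unfold outputPenalty
    linarith
  · refine two_rpow_le_of_le (score_ge_pair (m := (m, m')) hm') ?_
    have := le_max_left (C.info₁₂ y (m, m') - (R₁ + R₂)) 0
    unfold outputPenalty
    linarith

/-- A wrong second message places the competitor in another cloud, so no penalty term is needed. -/
theorem score_ge_of_wrongPair₂ (hy : y ∈ C.wrongPair₂ S₁ S₂ l₁₂ m₁ m₂) :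
    (2 : ℝ) ^ ((n : ℝ) * C.outputPenalty l₁₂ R₁ R₂ 0 0 ((S₁ + S₂) - (R₁ + R₂)) m₁ m₂ y) ≤
      C.score m₁ m₂ y := by
  obtain ⟨m, hm, h⟩ := hy
  refine two_rpow_le_of_le (score_ge_pair hm) ?_
  have := le_max_left (C.info₁₂ y m - (R₁ + R₂)) 0
  unfold outputPenalty
  linarith

theorem score_ge_of_rivalCloud (hl : 1 ≤ l₂) (hy : y ∈ C.rivalCloud S₂ l₂ m₂) :
    (2 : ℝ) ^ ((n : ℝ) * C.outputPenalty 0 0 0 (1 / l₂) S₂ 0 m₁ m₂ y) ≤ C.score m₁ m₂ y := by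
  obtain ⟨m, hm, h⟩ := hy
  refine two_rpow_le_of_le (score_ge_cloud hm) ?_
  have := inv_mul_max_le hl h
  unfold outputPenalty
  linarith

theorem score_ge_of_wrongCloud (hy : y ∈ C.wrongCloud S₂ l₂ m₂) :
    (2 : ℝ) ^ ((n : ℝ) * C.outputPenalty 0 0 0 l₂ R₂ (S₂ - R₂) m₁ m₂ y) ≤ C.score m₁ m₂ y := by
  obtain ⟨m, hm, h⟩ := hy
  refine two_rpow_le_of_le (score_ge_cloud hm) ?_
  have := le_max_left (C.info₂ y m - R₂) 0
  unfold outputPenalty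
  linarith

end Codebook

/-! ### Probability bounds -/

theorem avg_mono {f g : Msg n R₁ → Msg n R₂ → ℝ} (h : ∀ m₁ m₂, f m₁ m₂ ≤ g m₁ m₂) :
    Code.avg f ≤ Code.avg g :=
  div_le_div_of_nonneg_right (Finset.sum_le_sum fun m₁ _ => Finset.sum_le_sum fun m₂ _ => h m₁ m₂)
    (by positivity)

theorem avg_nonneg {f : Msg n R₁ → Msg n R₂ → ℝ} (h : ∀ m₁ m₂, 0 ≤ f m₁ m₂) : 0 ≤ Code.avg f :=
  div_nonneg (Finset.sum_nonneg fun m₁ _ => Finset.sum_nonneg fun m₂ _ => h m₁ m₂) (by positivity)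

theorem avg_add (f g : Msg n R₁ → Msg n R₂ → ℝ) :
    Code.avg (fun m₁ m₂ => f m₁ m₂ + g m₁ m₂) = Code.avg f + Code.avg g := by
  simp only [Code.avg, Finset.sum_add_distrib, add_div]

theorem avg_mul_const (f : Msg n R₁ → Msg n R₂ → ℝ) (c : ℝ) :
    Code.avg (fun m₁ m₂ => f m₁ m₂ * c) = Code.avg f * c := by
  simp only [Code.avg, ← Finset.sum_mul, div_mul_eq_mul_div]

variable [Fintype X]

/-- An event that forces a large score has small probability. -/
theorem avg_blockProb_le (hn : 0 < n) {WY : X → Y → ℝ} (hW : ∀ x y, 0 ≤ WY x y)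
    (C : Codebook U X n R₁ R₂) {T : U × X → ℝ}
    (hT : ∀ m₁ m₂, seqType (pairSeq (C.u m₂) (C.x m₁ m₂)) = T) {B E l r₁ r₂ μ r c : ℝ}
    (hB : Code.avg (fun m₁ m₂ => ∑ y : Fin n → Y, C.weight m₁ m₂ y * C.score m₁ m₂ y) ≤ B)
    (hE : (E : EReal) ≤ penExp WY l r₁ r₂ μ r c T)
    (D : Msg n R₁ → Msg n R₂ → Set (Fin n → Y))
    (hD : ∀ m₁ m₂, ∀ y ∈ D m₁ m₂,
      (2 : ℝ) ^ ((n : ℝ) * C.outputPenalty l r₁ r₂ μ r c m₁ m₂ y) ≤ C.score m₁ m₂ y) :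
    Code.avg (fun m₁ m₂ => blockProb WY (C.x m₁ m₂) (D m₁ m₂)) ≤
      B * (2 : ℝ) ^ (-((n : ℝ) * E)) := by
  have hscore : ∀ m₁ m₂ (y : Fin n → Y), 0 ≤ C.score m₁ m₂ y := by
    intro m₁ m₂ y
    unfold Codebook.score
    have h1 := Codebook.sum_ite_two_rpow_nonneg (fun m : Msg n R₁ × Msg n R₂ => m.2 ≠ m₂)
      (fun m => (n : ℝ) * (C.info₁₂ y m - (R₁ + R₂)))
    have h2 := Codebook.sum_ite_two_rpow_nonneg (fun m : Msg n R₁ => m ≠ m₁)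
      (fun m => (n : ℝ) * (C.info₁₂ y (m, m₂) - C.info₂ y m₂ - R₁))
    have h3 := Codebook.sum_ite_two_rpow_nonneg (fun m : Msg n R₂ => m ≠ m₂)
      (fun m => (n : ℝ) * (C.info₂ y m - R₂))
    linarith
  refine le_trans ?_ (mul_le_mul_of_nonneg_right hB (by positivity))
  rw [← avg_mul_const]
  refine avg_mono fun m₁ m₂ => ?_
  rw [Finset.sum_mul]
  refine Finset.sum_le_sum fun y _ => ?_
  have hw := C.weight_pos m₁ m₂ y
  by_cases hy : y ∈ D m₁ m₂
  swap
  · rw [Set.indicator_of_notMem hy]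
    exact mul_nonneg (mul_nonneg hw.le (hscore _ _ _)) (by positivity)
  rw [Set.indicator_of_mem hy]
  -- The conditional type of `y` is one candidate in the infimum defining `penExp`, and its penalty
  -- is `outputPenalty`.
  obtain ⟨V, hV, hV'⟩ := exists_condType hn (pairSeq (C.u m₂) (C.x m₁ m₂)) y
  have hpen : penalty l r₁ r₂ μ r c T (fun p => (V p : Y → ℝ)) =
      C.outputPenalty l r₁ r₂ μ r c m₁ m₂ y := by
    unfold penalty Codebook.outputPenalty J₁₂ J₂ Codebook.info₁₂ Codebook.info₂ empInfo
    rw [← hT m₁ m₂, jointUY_seqType hV]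
    congr 6
    exact funext fun p => hV p.1 p.2
  have hEV := hE.trans (iInf_le _ V)
  rw [hpen, ← hT m₁ m₂] at hEV
  have h1 := prod_le_condLik_mul hn (pairSeq (C.u m₂) (C.x m₁ m₂)) y (chanUX WY)
    (fun a b => hW a.2 b) V hV hV' E _ hEV
  refine h1.trans ?_
  rw [show -((n : ℝ) * (E - C.outputPenalty l r₁ r₂ μ r c m₁ m₂ y)) =
      (n : ℝ) * C.outputPenalty l r₁ r₂ μ r c m₁ m₂ y + -((n : ℝ) * E) by ring,
    Real.rpow_add (by norm_num), ← mul_assoc]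
  refine mul_le_mul_of_nonneg_right ?_ (by positivity)
  exact mul_le_mul_of_nonneg_left (hD m₁ m₂ y hy) hw.le

end Decoder

/-! ### Matching the exponents with the common form; assembling the theorem. -/

section Main

theorem margY_mem {X Y Z : Type*} [Fintype Y] [Fintype Z] (W : X → stdSimplex ℝ (Y × Z)) (x : X) :
    margY W x ∈ stdSimplex ℝ Y := by
  refine ⟨fun y => Finset.sum_nonneg fun z _ => (W x).2.1 _, ?_⟩
  have := (W x).2.2
  rwa [Fintype.sum_prod_type] at this

variable {U X Y : Type*} [Fintype U] [Fintype X] [Fintype Y]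

theorem ErPen_le_penExp (P : U × X → ℝ) (WY : X → Y → ℝ) (l R₁ R₂ R : ℝ) :
    ErPen P WY l R₁ R₂ R ≤ penExp WY l R₁ R₂ (-1) R 0 P := by
  refine le_of_eq (iInf_congr fun V => ?_)
  unfold penalty
  congr 2
  ring

theorem iInf_add_coe_le {ι : Type*} (f : ι → EReal) (g : ι → ℝ) (c : ℝ) :
    (⨅ i, f i + (g i : EReal)) + (c : EReal) ≤ ⨅ i, f i + ((g i + c : ℝ) : EReal) := by
  refine le_iInf fun i => ?_
  rw [EReal.coe_add, ← add_assoc]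
  exact add_le_add_left (iInf_le _ i) _

theorem penExp_add_le (WY : X → Y → ℝ) (l r₁ r₂ μ r c : ℝ) (P : U × X → ℝ) :
    penExp WY l r₁ r₂ μ r 0 P + (c : EReal) ≤ penExp WY l r₁ r₂ μ r c P := by
  refine (iInf_add_coe_le _ _ c).trans (le_of_eq (iInf_congr fun V => ?_))
  unfold penalty
  congr 2
  ring

theorem Er₁₂_le_penExp (P : U × X → ℝ) (WY : X → Y → ℝ) (l R₁ R₂ : ℝ) :
    Er₁₂ P WY l R₁ R₂ ≤ penExp WY l R₁ R₂ 0 0 0 P := by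
  refine le_of_eq (iInf_congr fun V => ?_)
  unfold penalty
  congr 2
  ring

/-- For every blocklength there is a constant-composition codebook with polynomially bounded
average score. -/
theorem exists_codebook {n : ℕ} {R₁ R₂ : ℝ} (hR₁ : 0 ≤ R₁) (hR₂ : 0 ≤ R₂) (s : Fin n → U × X)
    (Y : Type*) [Fintype Y] :
    ∃ C : Codebook U X n R₁ R₂,
      (∀ m₁ m₂, seqType (pairSeq (C.u m₂) (C.x m₁ m₂)) = seqType s) ∧
      (0 < n → Code.avg (fun m₁ m₂ => ∑ y : Fin n → Y, C.weight m₁ m₂ y * C.score m₁ m₂ y) ≤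
        polyFactor U X Y n + 8 * (polyFactor U X Y n * polyFactor U X Y n)) := by
  -- Blocklength zero also needs a codebook, but no score bound is required of it.
  rcases Nat.eq_zero_or_pos n with h | hn
  · exact ⟨⟨fun _ i => (s i).1, fun _ _ i => (s i).2⟩, fun _ _ => rfl, fun h' => absurd h h'.ne'⟩
  · obtain ⟨C, h1, h2⟩ := exists_permBook_score_le (Y := Y)
      (fun i => (s i).1) (fun i => (s i).2) hn hR₁ hR₂
    exact ⟨C, h1, fun _ => h2⟩

end Main


end ABC

end

theorem theorem1 {U X Y Z : Type*} [Fintype U] [Fintype X] [Fintype Y] [Fintype Z]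
    (W : X → stdSimplex ℝ (Y × Z)) (P : stdSimplex ℝ (U × X))
    (R₁ R₂ : ℝ) (hR₁ : 0 ≤ R₁) (hR₂ : 0 ≤ R₂) :
    ∃ C : ∀ n : ℕ, ABC.Codebook U X n R₁ R₂,
      -- the codebooks have constant joint composition, converging to `P`
      (∃ T : ℕ → U × X → ℝ,
        (∀ n m₁ m₂, ABC.seqType (ABC.pairSeq ((C n).u m₂) ((C n).x m₁ m₂)) = T n) ∧
        Tendsto T atTop (𝓝 (P : U × X → ℝ))) ∧
      ∀ (S₁ S₂ l₁₂ l₂ : ℝ), R₁ ≤ S₁ → R₂ ≤ S₂ → 1 ≤ l₁₂ → 1 ≤ l₂ →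
      ∀ c : ∀ n : ℕ, ABC.Code X Y Z n R₁ R₂,
        (∀ n, ∃ φ : (Fin n → Z) → Option (ABC.Msg n R₂),
          c n = (C n).code S₁ S₂ l₁₂ l₂ φ) →
        ABC.ErPen P (ABC.margY W) (1 / l₁₂) S₁ S₂ R₂ ≤
          liminf (fun n => ABC.expo n ((c n).totalErr₁ (ABC.margY W))) atTop ∧
        ABC.ErPen P (ABC.margY W) l₁₂ R₁ R₂ R₂ + (((S₁ + S₂) - (R₁ + R₂) : ℝ) : EReal) ≤
          liminf (fun n => ABC.expo n ((c n).undetErr₁ (ABC.margY W))) atTop ∧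
        min (ABC.Er₁₂ P (ABC.margY W) l₁₂ R₁ R₂ + (((S₁ + S₂) - (R₁ + R₂) : ℝ) : EReal))
            (max (ABC.ErPen P (ABC.margY W) (1 / l₁₂) S₁ S₂ R₂)
              (ABC.Er₂ P (ABC.margY W) (1 / l₂) S₂)) ≤
          liminf (fun n => ABC.expo n ((c n).totalErr₂ (ABC.margY W))) atTop ∧
        min (ABC.Er₁₂ P (ABC.margY W) l₁₂ R₁ R₂ + (((S₁ + S₂) - (R₁ + R₂) : ℝ) : EReal))
            (max (ABC.ErPen P (ABC.margY W) (1 / l₁₂) S₁ S₂ R₂)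
              (ABC.Er₂ P (ABC.margY W) l₂ R₂ + ((S₂ - R₂ : ℝ) : EReal))) ≤
          liminf (fun n => ABC.expo n ((c n).undetErr₂ (ABC.margY W))) atTop := by
  open ABC in
  have hP : ∀ p, 0 ≤ (P : U × X → ℝ) p := P.2.1
  have hWs : ∀ x, margY W x ∈ stdSimplex ℝ Y := margY_mem W
  have hW : ∀ x y, 0 ≤ margY W x y := fun x => (hWs x).1
  have : Nonempty X := by
    by_contra h
    rw [not_nonempty_iff] at h
    have := P.2.2
    simp at this
  obtain ⟨s, hs⟩ := exists_seqType_tendsto P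
  -- The codebooks are fixed before the thresholds and `l₁₂`, `l₂` are introduced.
  choose C hC hscore using fun n => exists_codebook (R₁ := R₁) (R₂ := R₂) hR₁ hR₂ (s n) Y
  refine ⟨C, ⟨fun n => seqType (s n), hC, hs⟩, ?_⟩
  intro S₁ S₂ l₁₂ l₂ hS₁ hS₂ hl₁₂ hl₂ c hc
  choose φ hφ using hc
  obtain rfl : c = fun n => (C n).code S₁ S₂ l₁₂ l₂ (φ n) := funext hφ
  have hT : ∀ n p, 0 ≤ seqType (s n) p := fun n p => by rw [seqType_apply]; positivity
  set B : ℕ → ℝ := fun n => polyFactor U X Y n +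
    8 * (polyFactor U X Y n * polyFactor U X Y n) with hBdef
  have hBpos : ∀ n, 0 ≤ B n := fun n => by
    have := polyFactor_pos (U := U) (X := X) (Y := Y) n
    positivity
  have hB2 := eventually_polyFactor_le U X Y
  have hB1 : ∀ n (t : ℝ), 0 ≤ t → B n * t ≤ 2 * B n * t := fun n t ht => by
    nlinarith [mul_nonneg (hBpos n) ht]
  have key : ∀ {l r₁ r₂ μ r k : ℝ} {E : ℝ}
      (D : ∀ n, Msg n R₁ → Msg n R₂ → Set (Fin n → Y)),
      (∀ n m₁ m₂, ∀ y ∈ D n m₁ m₂,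
        (2 : ℝ) ^ ((n : ℝ) * (C n).outputPenalty l r₁ r₂ μ r k m₁ m₂ y) ≤
          (C n).score m₁ m₂ y) →
      (E : EReal) < penExp (margY W) l r₁ r₂ μ r k P →
      ∀ᶠ n : ℕ in atTop, Code.avg (fun m₁ m₂ => blockProb (margY W) ((C n).x m₁ m₂)
        (D n m₁ m₂)) ≤ B n * (2 : ℝ) ^ (-((n : ℝ) * E)) := by
    intro l r₁ r₂ μ r k E D hD hE
    filter_upwards [eventually_le_penExp hWs l r₁ r₂ μ r k hP hT hs hE, eventually_gt_atTop 0]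
      with n hn hn0
    exact avg_blockProb_le hn0 hW (C n) (hC n) (hscore n hn0) hn (D n) (hD n)
  have kR : ∀ {E : ℝ}, (E : EReal) < ErPen P (margY W) (1 / l₁₂) S₁ S₂ R₂ → _ := fun {E} hE =>
    key (fun n => (C n).rivalPair S₁ S₂ l₁₂)
      (fun n m₁ m₂ y hy => Codebook.score_ge_of_rivalPair hl₁₂ hy)
      (hE.trans_le (ErPen_le_penExp _ _ _ _ _ _))
  have kW : ∀ {E : ℝ}, (E : EReal) < Er₁₂ P (margY W) l₁₂ R₁ R₂ +
      (((S₁ + S₂) - (R₁ + R₂) : ℝ) : EReal) → _ := fun {E} hE =>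
    key (fun n => (C n).wrongPair₂ S₁ S₂ l₁₂)
      (fun n m₁ m₂ y hy => Codebook.score_ge_of_wrongPair₂ hy)
      (hE.trans_le ((add_le_add_left (Er₁₂_le_penExp _ _ _ _ _) _).trans
        (penExp_add_le _ _ _ _ _ _ _ _)))
  have combine : ∀ {E : ℝ} {F : EReal} (D D' : ∀ n, Msg n R₁ → Msg n R₂ → Set (Fin n → Y)),
      (∀ n m₁ m₂, D n m₁ m₂ ⊆ (C n).wrongPair₂ S₁ S₂ l₁₂ m₁ m₂ ∪
        ((C n).rivalPair S₁ S₂ l₁₂ m₁ m₂ ∩ D' n m₁ m₂)) →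
      ((E : EReal) < F → ∀ᶠ n : ℕ in atTop, Code.avg (fun m₁ m₂ =>
        blockProb (margY W) ((C n).x m₁ m₂) (D' n m₁ m₂)) ≤ B n * (2 : ℝ) ^ (-((n : ℝ) * E))) →
      (E : EReal) < min (Er₁₂ P (margY W) l₁₂ R₁ R₂ + (((S₁ + S₂) - (R₁ + R₂) : ℝ) : EReal))
        (max (ErPen P (margY W) (1 / l₁₂) S₁ S₂ R₂) F) →
      ∀ᶠ n : ℕ in atTop, Code.avg (fun m₁ m₂ => blockProb (margY W) ((C n).x m₁ m₂)
        (D n m₁ m₂)) ≤ 2 * B n * (2 : ℝ) ^ (-((n : ℝ) * E)) := by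
    intro E F D D' hD hD' hE
    obtain ⟨hE1, hE2⟩ := lt_min_iff.1 hE
    have h2 : ∀ᶠ n : ℕ in atTop, Code.avg (fun m₁ m₂ => blockProb (margY W) ((C n).x m₁ m₂)
        ((C n).rivalPair S₁ S₂ l₁₂ m₁ m₂ ∩ D' n m₁ m₂)) ≤
          B n * (2 : ℝ) ^ (-((n : ℝ) * E)) := by
      -- An intersection is no likelier than either event, so the better of the two exponents
      -- applies; the union with `wrongPair₂` then produces the minimum and a factor 2.
      rcases lt_max_iff.1 hE2 with h | h
      · filter_upwards [kR h] with n hn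
        exact (avg_mono fun m₁ m₂ => blockProb_mono hW _ Set.inter_subset_left).trans hn
      · filter_upwards [hD' h] with n hn
        exact (avg_mono fun m₁ m₂ => blockProb_mono hW _ Set.inter_subset_right).trans hn
    filter_upwards [kW hE1, h2] with n h1 h2
    refine (avg_mono fun m₁ m₂ => (blockProb_mono hW _ (hD n m₁ m₂)).trans
      (blockProb_union_le hW _ _ _)).trans ?_
    rw [avg_add]
    linarith
  refine ⟨?_, ?_, ?_, ?_⟩
  · refine expo_liminf_ge (B := fun n => 2 * B n)
      (fun n => avg_nonneg fun _ _ => blockProb_nonneg hW _ _) hB2 fun E hE => ?_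
    filter_upwards [kR hE] with n hn
    refine (avg_mono fun m₁ m₂ => blockProb_mono hW _ ?_).trans
      (hn.trans (hB1 n _ (by positivity)))
    exact fun y hy => Codebook.mem_rivalPair_of_fst_ne hS₁ hS₂ hl₁₂ hy
  · refine expo_liminf_ge (B := fun n => 2 * B n)
      (fun n => avg_nonneg fun _ _ => blockProb_nonneg hW _ _) hB2 fun E hE => ?_
    filter_upwards [key (fun n => (C n).wrongPair₁ S₁ S₂ l₁₂)
      (fun n m₁ m₂ y hy => Codebook.score_ge_of_wrongPair₁ hy)
      (hE.trans_le ((add_le_add_left (ErPen_le_penExp _ _ _ _ _ _) _).trans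
        (penExp_add_le _ _ _ _ _ _ _ _)))] with n hn
    refine (avg_mono fun m₁ m₂ => blockProb_mono hW _ ?_).trans
      (hn.trans (hB1 n _ (by positivity)))
    intro y hy
    obtain ⟨m, hm, h⟩ := Set.mem_iUnion₂.1 hy
    exact Codebook.mem_wrongPair₁_of_fst_eq hm h
  · refine expo_liminf_ge (B := fun n => 2 * B n)
      (fun n => avg_nonneg fun _ _ => blockProb_nonneg hW _ _) hB2 fun E hE => ?_
    refine combine _ (fun n _ m₂ => (C n).rivalCloud S₂ l₂ m₂) ?_ ?_ hE
    · exact fun n m₁ m₂ y hy => Codebook.mem_of_snd_ne hS₁ hS₂ hl₁₂ hl₂ hy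
    · exact fun h => key _ (fun n m₁ m₂ y hy => Codebook.score_ge_of_rivalCloud hl₂ hy)
        (h.trans_le (Er₂_le_penExp _ hW _ _ _ hP))
  · refine expo_liminf_ge (B := fun n => 2 * B n)
      (fun n => avg_nonneg fun _ _ => blockProb_nonneg hW _ _) hB2 fun E hE => ?_
    refine combine _ (fun n _ m₂ => (C n).wrongCloud S₂ l₂ m₂) ?_ ?_ hE
    · intro n m₁ m₂ y hy
      obtain ⟨m, hm, h⟩ := Set.mem_iUnion₂.1 hy
      exact Codebook.mem_of_snd_eq hS₁ hS₂ hl₁₂ hm h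
    · exact fun h => key _ (fun n m₁ m₂ y hy => Codebook.score_ge_of_wrongCloud hy)
        (h.trans_le ((add_le_add_left (Er₂_le_penExp _ hW _ _ _ hP) _).trans
          (penExp_add_le _ _ _ _ _ _ _ _)))
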